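/- Let $\mathcal X$ be a finite non-empty set and let $r(x,y)\ge 0$ ($x,y\in\mathcal X$) be transition rates with $\sum_y r(x,y)>0$ for every $x$, which are irreducible, i.e. any state can be reached from any other by successive jumps with positive rate. Let $g:\mathbb R\times\mathcal X\times\mathcal X\to\mathbb R$ be bounded, measurable in time, and $T$-periodic in time, with $T>0$. For $\lambda\in\mathbb R$ let $(X^\lambda_t)_{t\ge 0}$ be the time-inhomogeneous Markov jump process with rates $r^\lambda(t,x,y)=e^{\lambda g(t,x,y)}r(x,y)$: if it is in $x$ after a jump at time $s$ (or at the initial time $s=0$), it stays there until a random time $\tau$ with $P(\tau>t)=\exp\{-\int_s^t \sum_y r^\lambda(v,x,y)\,dv\}$ for $t\ge s$, and, given $\tau$, it then jumps to $y$ with probability $r^\lambda(\tau,x,y)/\sum_z r^\lambda(\tau,x,z)$. Then the unperturbed process ($\lambda=0$) has a unique invariant distribution $\pi$, and $\pi(x)>0$ for all $x$. For each $\lambda$ the chain $(X^\lambda_{nT})_{n\ge 0}$ has a unique invariant distribution $\pi_\lambda$; the process $X^\lambda$ started from $\pi_\lambda$ is called the oscillatory steady state (OSS), and $\pi_{\lambda,t}(x):=\mathbb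 P_{\pi_\lambda}(X^\lambda_t=x)$ denotes its marginal at time $t\ge 0$. Put $r^*(x,y):=\pi(y)r(y,x)/\pi(x)$, $$\mathcal L^*f(x):=\sum_{y}r^*(x,y)\,[f(y)-f(x)],\qquad \psi_t(x):=\sum_{y}\bigl(r^*(x,y)g(t,y,x)-r(x,y)g(t,x,y)\bigr).$$ ($\mathcal L^*$ is the adjoint in $L^2(\pi)$ of the generator of the unperturbed process.) (i) For every $x$ the map $\lambda\mapsto\pi_\lambda(x)$ is differentiable at $\lambda=0$, the function $s\mapsto e^{s\mathcal L^*}\psi_{-s}$ is integrable on $(0,\infty)$, and $a(x):=\partial_{\lambda=0}\pi_\lambda(x)/\pi(x)$ satisfies $$a=\int_0^\infty e^{s\mathcal L^*}\psi_{-s}\,ds .$$ (ii) For every $t\ge 0$ and every $x$ the map $\lambda\mapsto\pi_{\lambda,t}(x)$ is differentiable at $\lambda=0$, the function $s\mapsto e^{s\mathcal L^*}\psi_{t-s}$ is integrable on $(0,\infty)$, and $a_t(x):=\partial_{\lambda=0}\pi_{\lambda,t}(x)/\pi(x)$ satisfies $$a_t=\int_0^\infty e^{s\mathcal L^*}\psi_{t-s}\,ds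 .$$ -/

import Mathlib

open MeasureTheory ProbabilityTheory Set

/-- Transition rates `rate t x y` (from `x` to `y` at time `t`) of a time-inhomogeneous Markov jump
process on a finite set: measurable in time, nonnegative, uniformly bounded, and with total exit
rates that are uniformly bounded away from zero. -/
structure JumpRates (X : Type*) [Fintype X] where
  rate : ℝ → X → X → ℝ
  measurable_rate : ∀ x y, Measurable fun t => rate t x y
  rate_nonneg : ∀ t x y, 0 ≤ rate t x y
  rate_bounded : ∃ C : ℝ, ∀ t x y, rate t x y ≤ C
  exit_pos : ∃ c : ℝ, 0 < c ∧ ∀ t x, c ≤ ∑ y, rate t x y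

namespace JumpRates

variable {X : Type*} [Fintype X]

/-- The holding time parameter `r̂_t(x) = ∑ y, r_t(x, y)`. -/
noncomputable def exitRate (R : JumpRates X) (t : ℝ) (x : X) : ℝ := ∑ y, R.rate t x y

/-- Given that the process is at `p.2` since time `p.1`, this is the density at `q` (with respect to
Lebesgue times counting measure) of (time of the next jump, state after the next jump).
The next jump time `τ` satisfies `P(τ > t) = exp (- ∫ v in p.1..t, r̂_v(p.2))`, so it has the density
`r̂_u(p.2) * exp (- ∫ v in p.1..u, r̂_v(p.2))` on `u > p.1`; given `τ = u`, the new state is `y` with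
probability `r_u(p.2, y) / r̂_u(p.2)`. -/
noncomputable def jumpDensity (R : JumpRates X) (p q : ℝ × X) : ENNReal :=
  (Ioi p.1).indicator
    (fun u => ENNReal.ofReal (Real.exp (-∫ v in p.1..u, R.exitRate v p.2) * R.rate u p.2 q.2)) q.1

lemma exitRate_measurable (R : JumpRates X) (x : X) : Measurable fun t => R.exitRate t x := by
  unfold exitRate
  exact Finset.measurable_sum _ fun y _ => R.measurable_rate x y

lemma exitRate_nonneg (R : JumpRates X) (t : ℝ) (x : X) : 0 ≤ R.exitRate t x :=
  Finset.sum_nonneg fun y _ => R.rate_nonneg t x y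

lemma exitRate_bounded (R : JumpRates X) : ∃ C : ℝ, ∀ t x, ‖R.exitRate t x‖ ≤ C := by
  obtain ⟨C, hC⟩ := R.rate_bounded
  refine ⟨∑ _y : X, C, fun t x => ?_⟩
  rw [Real.norm_of_nonneg (R.exitRate_nonneg t x)]
  exact Finset.sum_le_sum fun y _ => hC t x y

lemma exitRate_intervalIntegrable (R : JumpRates X) (x : X) (a b : ℝ) :
    IntervalIntegrable (fun t => R.exitRate t x) volume a b := by
  obtain ⟨C, hC⟩ := R.exitRate_bounded
  refine (intervalIntegrable_const (c := C)).mono_fun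
    (R.exitRate_measurable x).aestronglyMeasurable (Filter.Eventually.of_forall fun t => ?_)
  exact (hC t x).trans (le_abs_self C)

/-- The survival probability `exp (- ∫ v in s..u, r̂_v(x))` of the holding time. -/
noncomputable def survival (R : JumpRates X) (s : ℝ) (x : X) (u : ℝ) : ℝ :=
  Real.exp (-∫ v in s..u, R.exitRate v x)

lemma integral_exit_density (R : JumpRates X) (s t : ℝ) (hst : s ≤ t) (x : X) :
    ∫ u in s..t, Real.exp (-∫ v in s..u, R.exitRate v x) * R.exitRate u x
      = 1 - R.survival s x t := by
  obtain ⟨C, hC⟩ := R.exitRate_bounded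
  have hint := R.exitRate_intervalIntegrable x
  have hC0 : 0 ≤ C := (norm_nonneg _).trans (hC 0 x)
  have key : ∀ a b : ℝ, s ≤ a → a ≤ b → ‖R.survival s x a - R.survival s x b‖ ≤ C * (b - a) := by
    intro a b ha hab
    have h1 : (∫ v in s..b, R.exitRate v x)
        = (∫ v in s..a, R.exitRate v x) + ∫ v in a..b, R.exitRate v x :=
      (intervalIntegral.integral_add_adjacent_intervals (hint s a) (hint a b)).symm
    have h2 : 0 ≤ ∫ v in s..a, R.exitRate v x :=
      intervalIntegral.integral_nonneg ha fun v _ => R.exitRate_nonneg v x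
    have h3 : 0 ≤ ∫ v in a..b, R.exitRate v x :=
      intervalIntegral.integral_nonneg hab fun v _ => R.exitRate_nonneg v x
    have h4 : ‖∫ v in a..b, R.exitRate v x‖ ≤ C * |b - a| :=
      intervalIntegral.norm_integral_le_of_norm_le_const fun v _ => hC v x
    rw [Real.norm_of_nonneg h3, abs_of_nonneg (sub_nonneg.2 hab)] at h4
    unfold survival
    rw [h1, neg_add, Real.exp_add]
    set I := ∫ v in s..a, R.exitRate v x
    set J := ∫ v in a..b, R.exitRate v x
    have e1 : Real.exp (-I) ≤ 1 := Real.exp_le_one_iff.2 (by linarith)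
    have e2 : Real.exp (-J) ≤ 1 := Real.exp_le_one_iff.2 (by linarith)
    have e3 := Real.add_one_le_exp (-J)
    have e4 := Real.exp_pos (-I)
    rw [Real.norm_of_nonneg (by nlinarith)]
    nlinarith
  have hlip : LipschitzOnWith C.toNNReal (R.survival s x) (uIcc s t) := by
    rw [uIcc_of_le hst]
    refine LipschitzOnWith.of_dist_le_mul fun a ha b hb => ?_
    rw [Real.coe_toNNReal _ hC0, dist_eq_norm, Real.dist_eq]
    rcases le_total a b with hab | hab
    · rw [abs_sub_comm, abs_of_nonneg (sub_nonneg.2 hab)]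
      exact key a b ha.1 hab
    · rw [norm_sub_rev, abs_of_nonneg (sub_nonneg.2 hab)]
      exact key b a hb.1 hab
  have hFTC := hlip.absolutelyContinuousOnInterval.integral_deriv_eq_sub
  have hder : ∫ u in s..t, deriv (R.survival s x) u
      = ∫ u in s..t, -(Real.exp (-∫ v in s..u, R.exitRate v x) * R.exitRate u x) := by
    refine intervalIntegral.integral_congr_ae ?_
    filter_upwards [(hint s t).ae_hasDerivAt_integral] with u hu hus
    have := ((hu (uIoc_subset_uIcc hus) s left_mem_uIcc).neg.exp).deriv
    rw [show R.survival s x = fun u => Real.exp (-∫ v in s..u, R.exitRate v x) from rfl]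
    refine Eq.trans this ?_
    simp
  rw [hder, intervalIntegral.integral_neg] at hFTC
  have hs : R.survival s x s = 1 := by simp [survival]
  linarith

lemma tendsto_survival (R : JumpRates X) (s : ℝ) (x : X) :
    Filter.Tendsto (R.survival s x) Filter.atTop (nhds 0) := by
  obtain ⟨c, hc, hcle⟩ := R.exit_pos
  have hint := R.exitRate_intervalIntegrable x
  refine Real.tendsto_exp_neg_atTop_nhds_zero.comp ?_
  refine Filter.tendsto_atTop_mono' (f₁ := fun u => c * (u - s)) Filter.atTop ?_ ?_
  · filter_upwards [Filter.eventually_ge_atTop s] with u hu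
    have := intervalIntegral.integral_mono_on hu (intervalIntegrable_const (c := c)) (hint s u)
      fun v _ => hcle v x
    simpa [mul_comm] using this
  · exact (Filter.tendsto_atTop_add_const_right _ (-s) Filter.tendsto_id).const_mul_atTop hc

lemma lintegral_exit_density (R : JumpRates X) (s : ℝ) (x : X) :
    ∫⁻ u in Ioi s, ENNReal.ofReal
      (Real.exp (-∫ v in s..u, R.exitRate v x) * R.exitRate u x) = 1 := by
  have hint := R.exitRate_intervalIntegrable x
  have hnn : ∀ u, 0 ≤ Real.exp (-∫ v in s..u, R.exitRate v x) * R.exitRate u x :=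
    fun u => mul_nonneg (Real.exp_pos _).le (R.exitRate_nonneg u x)
  have hcont : Continuous fun u => Real.exp (-∫ v in s..u, R.exitRate v x) :=
    Real.continuous_exp.comp (intervalIntegral.continuous_primitive hint s).neg
  have hlim : Filter.Tendsto
      (fun t => ∫ u in s..t, Real.exp (-∫ v in s..u, R.exitRate v x) * R.exitRate u x)
      Filter.atTop (nhds 1) := by
    have h := (tendsto_const_nhds (x := (1 : ℝ))).sub (R.tendsto_survival s x)
    rw [sub_zero] at h
    refine h.congr' ?_
    filter_upwards [Filter.eventually_ge_atTop s] with t ht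
    exact (R.integral_exit_density s t ht x).symm
  have hii : ∀ a b : ℝ, IntervalIntegrable
      (fun u => Real.exp (-∫ v in s..u, R.exitRate v x) * R.exitRate u x) volume a b :=
    fun a b => (hint a b).continuousOn_mul hcont.continuousOn
  have hI : IntegrableOn
      (fun u => Real.exp (-∫ v in s..u, R.exitRate v x) * R.exitRate u x) (Ioi s) := by
    refine integrableOn_Ioi_of_intervalIntegral_norm_tendsto 1 s (b := id)
      (fun t => ?_) Filter.tendsto_id ?_
    · rcases le_total s t with h | h
      · exact (intervalIntegrable_iff_integrableOn_Ioc_of_le h).1 (hii s t)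
      · rw [id, Ioc_eq_empty_of_le h]
        exact integrableOn_empty
    · simpa only [Real.norm_of_nonneg (hnn _), id] using hlim
  have hval := tendsto_nhds_unique (intervalIntegral_tendsto_integral_Ioi s hI Filter.tendsto_id)
    hlim
  rw [← ofReal_integral_eq_lintegral_ofReal hI (Filter.Eventually.of_forall hnn), hval,
    ENNReal.ofReal_one]

variable [MeasurableSpace X] [MeasurableSingletonClass X]

lemma measurable_jumpDensity (R : JumpRates X) :
    Measurable (Function.uncurry R.jumpDensity) := by
  have hF : ∀ x, Measurable fun p : ℝ × ℝ => ∫ v in p.1..p.2, R.exitRate v x := by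
    intro x
    have hint := R.exitRate_intervalIntegrable x
    have h0 : Continuous fun t => ∫ v in (0 : ℝ)..t, R.exitRate v x :=
      intervalIntegral.continuous_primitive hint 0
    have : (fun p : ℝ × ℝ => ∫ v in p.1..p.2, R.exitRate v x) = fun p =>
        (∫ v in (0 : ℝ)..p.2, R.exitRate v x) - ∫ v in (0 : ℝ)..p.1, R.exitRate v x := by
      funext p
      exact (intervalIntegral.integral_interval_sub_left (hint _ _) (hint _ _)).symm
    rw [this]
    exact ((h0.comp continuous_snd).sub (h0.comp continuous_fst)).measurable
  have hx : ∀ z : X × X, Measurable fun p : ℝ × ℝ => R.jumpDensity (p.1, z.1) (p.2, z.2) := by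
    intro z
    have : (fun p : ℝ × ℝ => R.jumpDensity (p.1, z.1) (p.2, z.2)) =
        {p : ℝ × ℝ | p.1 < p.2}.indicator fun p => ENNReal.ofReal
          (Real.exp (-∫ v in p.1..p.2, R.exitRate v z.1) * R.rate p.2 z.1 z.2) := by
      funext p
      simp [jumpDensity, indicator_apply]
    rw [this]
    refine Measurable.indicator ?_ (measurableSet_lt measurable_fst measurable_snd)
    exact ENNReal.measurable_ofReal.comp ((Real.measurable_exp.comp (hF z.1).neg).mul
      ((R.measurable_rate z.1 z.2).comp measurable_snd))
  have hj : Measurable fun q : (ℝ × ℝ) × (X × X) =>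
      R.jumpDensity (q.1.1, q.2.1) (q.1.2, q.2.2) :=
    measurable_from_prod_countable_left hx
  exact hj.comp (f := fun q : (ℝ × X) × (ℝ × X) => ((q.1.1, q.2.1), (q.1.2, q.2.2)))
    (by fun_prop)

/-- The transition kernel of the chain of (jump times, states after the jumps). -/
noncomputable def jumpKernel (R : JumpRates X) : Kernel (ℝ × X) (ℝ × X) :=
  Kernel.withDensity (Kernel.const (ℝ × X) ((volume : Measure ℝ).prod Measure.count)) R.jumpDensity

instance (R : JumpRates X) : IsMarkovKernel R.jumpKernel := by
  refine ⟨fun p => ⟨?_⟩⟩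
  have hm : Measurable (R.jumpDensity p) := R.measurable_jumpDensity.comp measurable_prodMk_left
  rw [jumpKernel, Kernel.withDensity_apply _ R.measurable_jumpDensity,
    withDensity_apply _ MeasurableSet.univ, Measure.restrict_univ, Kernel.const_apply,
    lintegral_prod _ hm.aemeasurable, ← R.lintegral_exit_density p.1 p.2,
    ← lintegral_indicator measurableSet_Ioi]
  refine lintegral_congr fun u => ?_
  rw [lintegral_count, tsum_fintype]
  simp only [jumpDensity, indicator_apply]
  split_ifs with hu
  · rw [← ENNReal.ofReal_sum_of_nonneg fun y _ =>
      mul_nonneg (Real.exp_pos _).le (R.rate_nonneg u p.2 y), ← Finset.mul_sum]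
    rfl
  · simp

/-- Initial law of the chain: the process starts at time `0` in a state with distribution `ν`. -/
noncomputable def startLaw (ν : X → ℝ) : Measure (ℝ × X) :=
  ∑ x, ENNReal.ofReal (ν x) • Measure.dirac ((0 : ℝ), x)

/-- The law of the sequence (jump time, state after the jump), `n = 0, 1, 2, …`, of the Markov jump
process with rates `R` and initial distribution `ν` at time `0`. -/
noncomputable def pathLaw (R : JumpRates X) (ν : X → ℝ) : Measure (ℕ → ℝ × X) :=
  Kernel.trajMeasure (X := fun _ => ℝ × X) (startLaw ν) fun n =>
    R.jumpKernel.comap (fun h : (i : Finset.Iic n) → ℝ × X => h ⟨n, Finset.mem_Iic.2 le_rfl⟩)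
      (measurable_pi_apply _)

open Classical in
/-- The state `X_t` at time `t`: the state entered at the `n`-th jump if
`τ_n ≤ t < τ_{n+1}`, and the cemetery state `none` if there is no such `n`. -/
noncomputable def stateAt (t : ℝ) (ω : ℕ → ℝ × X) : Option X :=
  if h : ∃ n, (ω n).1 ≤ t ∧ t < (ω (n + 1)).1 then some (ω (Nat.find h)).2 else none

/-- The marginal `P_ν(X_t = x)` at time `t` of the process with initial distribution `ν`. -/
noncomputable def marginal (R : JumpRates X) (ν : X → ℝ) (t : ℝ) (x : X) : ℝ :=
  (R.pathLaw ν).real {ω | stateAt t ω = some x}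

/-- `ν` is an invariant distribution of the process: started from `ν`, it has law `ν` at all
times. -/
def IsInvariant (R : JumpRates X) (ν : X → ℝ) : Prop :=
  ν ∈ stdSimplex ℝ X ∧ ∀ t, 0 ≤ t → R.marginal ν t = ν

/-- `ν` is an invariant distribution of the process observed at the times `0, T, 2T, …`
(for rates of period `T` in time); the process started from such a `ν` is the oscillatory steady
state. -/
def IsPeriodicInvariant (R : JumpRates X) (T : ℝ) (ν : X → ℝ) : Prop :=
  ν ∈ stdSimplex ℝ X ∧ R.marginal ν T = ν

end JumpRates

namespace MarkovChain

variable {X : Type*} [Fintype X]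

/-- Irreducibility: any state can be reached from any other one through positive rates. -/
def IsIrreducible (r : X → X → ℝ) : Prop :=
  ∀ x y, Relation.ReflTransGen (fun a b => 0 < r a b) x y

lemma exists_exit_lower_bound (r : X → X → ℝ) (hpos : ∀ x, 0 < ∑ y, r x y) :
    ∃ c : ℝ, 0 < c ∧ ∀ x, c ≤ ∑ y, r x y := by
  rcases isEmpty_or_nonempty X with h | h
  · exact ⟨1, one_pos, fun x => isEmptyElim x⟩
  · obtain ⟨x₀, hx₀⟩ := Finite.exists_min fun x => ∑ y, r x y
    exact ⟨_, hpos x₀, hx₀⟩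

lemma exists_rate_upper_bound (r : X → X → ℝ) (hr : ∀ x y, 0 ≤ r x y) :
    ∃ C : ℝ, ∀ x y, r x y ≤ C :=
  ⟨∑ x, ∑ y, r x y, fun x y =>
    (Finset.single_le_sum (fun y _ => hr x y) (Finset.mem_univ y)).trans
      (Finset.single_le_sum (f := fun x => ∑ y, r x y)
        (fun x _ => Finset.sum_nonneg fun y _ => hr x y) (Finset.mem_univ x))⟩

/-- The unperturbed process: the rates `r(x, y)` do not depend on time. -/
def unperturbed (r : X → X → ℝ) (hr : ∀ x y, 0 ≤ r x y) (hpos : ∀ x, 0 < ∑ y, r x y) :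
    JumpRates X where
  rate _ x y := r x y
  measurable_rate _ _ := measurable_const
  rate_nonneg _ x y := hr x y
  rate_bounded := (exists_rate_upper_bound r hr).imp fun _ h _ x y => h x y
  exit_pos := (exists_exit_lower_bound r hpos).imp fun _ h => ⟨h.1, fun _ x => h.2 x⟩

/-- The perturbed process: the rates are `exp (lam * g(t, x, y)) * r(x, y)`. -/
noncomputable def perturbed (r : X → X → ℝ) (hr : ∀ x y, 0 ≤ r x y)
    (hpos : ∀ x, 0 < ∑ y, r x y) (g : ℝ → X → X → ℝ) (hgm : ∀ x y, Measurable fun t => g t x y)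
    (hgb : ∃ G : ℝ, ∀ t x y, |g t x y| ≤ G) (lam : ℝ) : JumpRates X where
  rate t x y := Real.exp (lam * g t x y) * r x y
  measurable_rate x y := (Real.measurable_exp.comp ((hgm x y).const_mul lam)).mul_const _
  rate_nonneg t x y := mul_nonneg (Real.exp_pos _).le (hr x y)
  rate_bounded := by
    obtain ⟨G, hG⟩ := hgb
    obtain ⟨C, hC⟩ := exists_rate_upper_bound r hr
    refine ⟨Real.exp (|lam| * G) * C, fun t x y => ?_⟩
    refine mul_le_mul (Real.exp_le_exp.2 ?_) (hC x y) (hr x y) (Real.exp_pos _).le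
    exact (le_abs_self _).trans
      ((abs_mul _ _).le.trans (mul_le_mul_of_nonneg_left (hG t x y) (abs_nonneg _)))
  exit_pos := by
    obtain ⟨G, hG⟩ := hgb
    obtain ⟨c, hc, hcle⟩ := exists_exit_lower_bound r hpos
    refine ⟨Real.exp (-(|lam| * G)) * c, mul_pos (Real.exp_pos _) hc, fun t x => ?_⟩
    refine (mul_le_mul_of_nonneg_left (hcle x) (Real.exp_pos _).le).trans ?_
    rw [Finset.mul_sum]
    refine Finset.sum_le_sum fun y _ =>
      mul_le_mul_of_nonneg_right (Real.exp_le_exp.2 ?_) (hr x y)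
    have h := (neg_le_abs (lam * g t x y)).trans
      ((abs_mul _ _).le.trans (mul_le_mul_of_nonneg_left (hG t x y) (abs_nonneg _)))
    linarith

/-- The rates `r*(x, y) = π(y) r(y, x) / π(x)` of the time-reversed stationary process. -/
noncomputable def rStar (r : X → X → ℝ) (π : X → ℝ) (x y : X) : ℝ := π y * r y x / π x

/-- The adjoint in `L²(π)` of the generator,
`L* f (x) = ∑ y, r*(x, y) (f(y) - f(x))`, on the finite-dimensional space of functions on `X`. -/
noncomputable def LStar (r : X → X → ℝ) (π : X → ℝ) : (X → ℝ) →L[ℝ] (X → ℝ) :=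
  LinearMap.toContinuousLinearMap
    { toFun := fun f x => ∑ y, rStar r π x y * (f y - f x)
      map_add' := fun f h => by
        funext x
        simp only [Pi.add_apply, ← Finset.sum_add_distrib]
        exact Finset.sum_congr rfl fun y _ => by ring
      map_smul' := fun c f => by
        funext x
        simp only [Pi.smul_apply, smul_eq_mul, RingHom.id_apply, Finset.mul_sum]
        exact Finset.sum_congr rfl fun y _ => by ring }

/-- `ψ_t(x) = ∑ y, (r*(x, y) g(t, y, x) - r(x, y) g(t, x, y))`. -/
noncomputable def psi (r : X → X → ℝ) (g : ℝ → X → X → ℝ) (π : X → ℝ) (t : ℝ) (x : X) : ℝ :=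
  ∑ y, (rStar r π x y * g t y x - r x y * g t x y)

end MarkovChain

/-! The marginals of the oscillatory steady state are the periodic solution `p` of the forward
equation `p' = A p + (L - A) p`, where `A` is the forward operator of the unperturbed process and
`L` the perturbed one. Since `A π = 0`, Duhamel's formula started `n` periods ago expresses
`p - π` by the initial deviation, propagated by `exp (s A)`, and the convolution of `exp (s A)` with
the forcing `(L - A) p`. All these vectors have total mass zero, and on such vectors `exp (s A)`
contracts exponentially by Dobrushin's argument (irreducibility makes the transition probabilities
positive), so for `n → ∞` only the convolution over `(0, ∞)` survives. To first order in `λ`,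
uniformly in time, `L - A` is `λ` times the forward operator `B` with rates `r g`, and `p` is `π`;
hence the derivative is the convolution of `exp (s A)` with `B π`. Multiplication by `π`
conjugates `L*` to `A` and maps `ψ` to `B π`. -/

/-! ### The jump chain and its path law -/

namespace JumpRates

section JumpKernel

variable {X : Type*} [Fintype X]

lemma survival_pos (R : JumpRates X) (s : ℝ) (x : X) (t : ℝ) : 0 < R.survival s x t :=
  Real.exp_pos _

lemma survival_mul_survival (R : JumpRates X) (s t u : ℝ) (x : X) :
    R.survival s x t * R.survival t x u = R.survival s x u := by
  have hint := R.exitRate_intervalIntegrable x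
  unfold survival
  rw [← Real.exp_add, ← neg_add,
    intervalIntegral.integral_add_adjacent_intervals (hint s t) (hint t u)]

lemma continuous_survival_uncurry (R : JumpRates X) (x : X) :
    Continuous fun z : ℝ × ℝ => R.survival z.1 x z.2 := by
  have hprim (s : ℝ) : Continuous fun t => R.survival s x t :=
    Real.continuous_exp.comp
      (intervalIntegral.continuous_primitive (R.exitRate_intervalIntegrable x) s).neg
  have hdiv : (fun z : ℝ × ℝ => R.survival z.1 x z.2) =
      fun z => R.survival 0 x z.2 / R.survival 0 x z.1 := by
    funext z
    rw [← R.survival_mul_survival 0 z.1 z.2 x, mul_div_cancel_left₀ _ (R.survival_pos _ _ _).ne']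
  rw [hdiv]
  exact ((hprim 0).comp continuous_snd).div ((hprim 0).comp continuous_fst)
    fun _ => (R.survival_pos _ _ _).ne'

variable [MeasurableSpace X] [MeasurableSingletonClass X]

lemma jumpKernel_prod_singleton (R : JumpRates X) (p : ℝ × X) (A : Set ℝ) (y : X) :
    R.jumpKernel p (A ×ˢ {y}) =
      ∫⁻ u in A ∩ Ioi p.1, ENNReal.ofReal (R.survival p.1 p.2 u * R.rate u p.2 y) := by
  have hm : Measurable (R.jumpDensity p) := R.measurable_jumpDensity.comp measurable_prodMk_left
  rw [jumpKernel, Kernel.withDensity_apply' _ R.measurable_jumpDensity, Kernel.const_apply,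
    ← Measure.prod_restrict, lintegral_prod _ hm.aemeasurable, Measure.restrict_singleton,
    Measure.count_singleton, one_smul, inter_comm, ← Measure.restrict_restrict measurableSet_Ioi,
    ← lintegral_indicator measurableSet_Ioi]
  refine lintegral_congr fun u => ?_
  rw [lintegral_dirac]
  rfl

lemma jumpKernel_prod_univ (R : JumpRates X) (p : ℝ × X) {A : Set ℝ} (hA : MeasurableSet A) :
    R.jumpKernel p (A ×ˢ univ) =
      ∫⁻ u in A ∩ Ioi p.1, ENNReal.ofReal (R.survival p.1 p.2 u * R.exitRate u p.2) := by
  have hcover : A ×ˢ (univ : Set X) = ⋃ y ∈ Finset.univ, A ×ˢ {y} := by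
    ext q
    simp
  have hdisj : ((Finset.univ : Finset X) : Set X).PairwiseDisjoint fun y => A ×ˢ ({y} : Set X) :=
    fun y _ z _ hyz => Set.disjoint_prod.2 (Or.inr (disjoint_singleton.2 hyz))
  have hm (y : X) : Measurable fun u =>
      ENNReal.ofReal (R.survival p.1 p.2 u * R.rate u p.2 y) :=
    ((((R.continuous_survival_uncurry p.2).measurable.comp measurable_prodMk_left)).mul
      (R.measurable_rate p.2 y)).ennreal_ofReal
  rw [hcover, measure_biUnion_finset hdisj fun y _ => hA.prod (measurableSet_singleton y)]
  simp_rw [R.jumpKernel_prod_singleton p A]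
  rw [← lintegral_finsetSum _ fun y _ => hm y]
  refine lintegral_congr fun u => ?_
  rw [← ENNReal.ofReal_sum_of_nonneg fun y _ =>
    mul_nonneg (R.survival_pos _ _ _).le (R.rate_nonneg u p.2 y), ← Finset.mul_sum, exitRate]

lemma jumpKernel_Ioi_prod_univ (R : JumpRates X) {p : ℝ × X} {t : ℝ} (ht : p.1 ≤ t) :
    R.jumpKernel p (Ioi t ×ˢ univ) = ENNReal.ofReal (R.survival p.1 p.2 t) := by
  rw [R.jumpKernel_prod_univ p measurableSet_Ioi, inter_eq_left.2 (Ioi_subset_Ioi ht)]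
  have hfactor (u : ℝ) : ENNReal.ofReal (R.survival p.1 p.2 u * R.exitRate u p.2) =
      ENNReal.ofReal (R.survival p.1 p.2 t) *
        ENNReal.ofReal (R.survival t p.2 u * R.exitRate u p.2) := by
    rw [← R.survival_mul_survival p.1 t u p.2, mul_assoc,
      ENNReal.ofReal_mul (R.survival_pos p.1 p.2 t).le]
  simp_rw [hfactor]
  rw [lintegral_const_mul' _ _ ENNReal.ofReal_ne_top]
  exact (congrArg _ (R.lintegral_exit_density t p.2)).trans (mul_one _)

lemma jumpKernel_Iic_prod_univ (R : JumpRates X) (p : ℝ × X) :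
    R.jumpKernel p (Iic p.1 ×ˢ univ) = 0 := by
  rw [R.jumpKernel_prod_univ p measurableSet_Iic, Iic_inter_Ioi, Ioc_self, Measure.restrict_empty,
    lintegral_zero_measure]

/-- The conditional probability, given that some jump at time `p.1` leads to the state `p.2`, that
the process is in `x` at time `t` without having jumped again. -/
noncomputable def stayWeight (R : JumpRates X) (t : ℝ) (x : X) : ℝ × X → ENNReal :=
  (Iic t ×ˢ {x}).indicator fun p => ENNReal.ofReal (R.survival p.1 x t)

lemma measurable_stayWeight_uncurry (R : JumpRates X) (x : X) :
    Measurable fun z : ℝ × (ℝ × X) => R.stayWeight z.1 x z.2 := by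
  have hset : MeasurableSet {z : ℝ × (ℝ × X) | z.2 ∈ Iic z.1 ×ˢ ({x} : Set X)} :=
    (measurableSet_le (by fun_prop) (by fun_prop)).inter
      ((by fun_prop : Measurable fun z : ℝ × (ℝ × X) => z.2.2) (measurableSet_singleton x))
  have hm : Measurable fun z : ℝ × (ℝ × X) => ENNReal.ofReal (R.survival z.2.1 x z.1) :=
    ((R.continuous_survival_uncurry x).measurable.comp
      (by fun_prop : Measurable fun z : ℝ × (ℝ × X) => (z.2.1, z.1))).ennreal_ofReal
  exact hm.indicator hset

lemma jumpKernel_Iic_prod_singleton (R : JumpRates X) (p : ℝ × X) (t : ℝ) (y : X) :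
    R.jumpKernel p (Iic t ×ˢ {y}) =
      ∫⁻ u in Iic t, ENNReal.ofReal (R.rate u p.2 y) * R.stayWeight u p.2 p := by
  rw [R.jumpKernel_prod_singleton p (Iic t), inter_comm,
    ← Measure.restrict_restrict measurableSet_Ioi, restrict_Ioi_eq_restrict_Ici,
    ← lintegral_indicator measurableSet_Ici]
  refine lintegral_congr fun u => ?_
  by_cases hu : p.1 ≤ u
  · simp [stayWeight, hu, mul_comm (R.survival _ _ _), ENNReal.ofReal_mul (R.rate_nonneg u p.2 y)]
  · simp [stayWeight, hu]

end JumpKernel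

section PathLaw

variable {X : Type*} [Fintype X] [MeasurableSpace X]

lemma isProbabilityMeasure_startLaw {ν : X → ℝ} (hν : ν ∈ stdSimplex ℝ X) :
    IsProbabilityMeasure (startLaw ν) := by
  refine ⟨?_⟩
  simp only [startLaw, Measure.coe_finsetSum, Finset.sum_apply, Measure.smul_apply, measure_univ,
    smul_eq_mul, mul_one]
  rw [← ENNReal.ofReal_sum_of_nonneg fun x _ => hν.1 x, hν.2, ENNReal.ofReal_one]

variable [MeasurableSingletonClass X] (R : JumpRates X) {ν : X → ℝ}

lemma isProbabilityMeasure_pathLaw (hν : ν ∈ stdSimplex ℝ X) :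
    IsProbabilityMeasure (R.pathLaw ν) := by
  have := isProbabilityMeasure_startLaw hν
  unfold pathLaw
  infer_instance

lemma map_eval_zero_pathLaw (hν : ν ∈ stdSimplex ℝ X) :
    (R.pathLaw ν).map (fun ω => ω 0) = startLaw ν := by
  have := isProbabilityMeasure_startLaw hν
  have hmap : (R.pathLaw ν).map (Preorder.frestrictLe 0)
      = (startLaw ν).map (MeasurableEquiv.piUnique (fun _ : Finset.Iic 0 => ℝ × X)).symm := by
    rw [pathLaw, Kernel.trajMeasure, Measure.map_comp _ _ (by fun_prop),
      Kernel.traj_map_frestrictLe, Kernel.partialTraj_self, Measure.id_comp]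
  have heval := congrArg (fun m : Measure ((i : Finset.Iic 0) → ℝ × X) =>
    m.map (fun z => z ⟨0, Finset.mem_Iic.2 le_rfl⟩)) hmap
  beta_reduce at heval
  rw [Measure.map_map (by fun_prop) (by fun_prop), Measure.map_map (by fun_prop) (by fun_prop)]
    at heval
  exact heval.trans Measure.map_id

lemma pathLaw_eval_succ (hν : ν ∈ stdSimplex ℝ X) (n : ℕ)
    {S : Set ((ℝ × X) × (ℝ × X))} (hS : MeasurableSet S) :
    R.pathLaw ν {ω | (ω n, ω (n + 1)) ∈ S} =
      ∫⁻ ω, R.jumpKernel (ω n) (Prod.mk (ω n) ⁻¹' S) ∂(R.pathLaw ν) := by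
  have := isProbabilityMeasure_startLaw hν
  have := R.isProbabilityMeasure_pathLaw hν
  let last (h : (i : Finset.Iic n) → ℝ × X) : ℝ × X := h ⟨n, Finset.mem_Iic.2 le_rfl⟩
  have hS' : MeasurableSet {z : ((i : Finset.Iic n) → ℝ × X) × (ℝ × X) | (last z.1, z.2) ∈ S} :=
    (by fun_prop : Measurable fun z : ((i : Finset.Iic n) → ℝ × X) × (ℝ × X) =>
      (last z.1, z.2)) hS
  have h := Kernel.map_frestrictLe_trajMeasure_compProd_eq_map_trajMeasure (X := fun _ => ℝ × X)
    (μ₀ := startLaw ν) (a := n) (κ := fun n =>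
      R.jumpKernel.comap (fun h : (i : Finset.Iic n) → ℝ × X => h ⟨n, Finset.mem_Iic.2 le_rfl⟩)
        (measurable_pi_apply _))
  have happly := congrArg (fun m => m {z | (last z.1, z.2) ∈ S}) h
  beta_reduce at happly
  rw [Measure.compProd_apply hS', Measure.map_apply (by fun_prop) hS',
    lintegral_map (Kernel.measurable_kernel_prodMk_left hS') (by fun_prop)] at happly
  exact happly.symm

lemma pathLaw_eval_mem_and_succ_mem (hν : ν ∈ stdSimplex ℝ X) (n : ℕ) {A B : Set (ℝ × X)}
    (hA : MeasurableSet A) (hB : MeasurableSet B) :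
    R.pathLaw ν {ω | ω n ∈ A ∧ ω (n + 1) ∈ B} =
      ∫⁻ ω, A.indicator (fun p => R.jumpKernel p B) (ω n) ∂(R.pathLaw ν) := by
  refine (R.pathLaw_eval_succ hν n (hA.prod hB)).trans (lintegral_congr fun ω => ?_)
  by_cases hω : ω n ∈ A
  · rw [mk_preimage_prod_right hω, indicator_of_mem hω]
  · rw [mk_preimage_prod_right_eq_empty hω, measure_empty, indicator_of_notMem hω]

lemma ae_strictMono_jumpTime (hν : ν ∈ stdSimplex ℝ X) :
    ∀ᵐ ω ∂(R.pathLaw ν), StrictMono fun n => (ω n).1 := by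
  suffices h : ∀ n, ∀ᵐ ω ∂(R.pathLaw ν), (ω n).1 < (ω (n + 1)).1 by
    filter_upwards [ae_all_iff.2 h] with ω hω using strictMono_nat_of_lt_succ hω
  intro n
  have hzero := R.pathLaw_eval_succ hν n (S := {z | z.2.1 ≤ z.1.1})
    (measurableSet_le (by fun_prop) (by fun_prop))
  have hsection (p : ℝ × X) :
      Prod.mk p ⁻¹' {z : (ℝ × X) × (ℝ × X) | z.2.1 ≤ z.1.1} = Iic p.1 ×ˢ univ := by
    ext q
    simp
  simp only [hsection, jumpKernel_Iic_prod_univ, lintegral_zero] at hzero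
  simpa only [ae_iff, not_lt] using! hzero

lemma ae_jumpTime_zero (hν : ν ∈ stdSimplex ℝ X) : ∀ᵐ ω ∂(R.pathLaw ν), (ω 0).1 = 0 := by
  have hS : MeasurableSet {p : ℝ × X | p.1 = 0} := measurable_fst (measurableSet_singleton 0)
  refine (ae_map_iff (f := fun ω : ℕ → ℝ × X => ω 0)
    (measurable_pi_apply 0).aemeasurable hS).1 ?_
  rw [R.map_eval_zero_pathLaw hν, ae_iff]
  simp [startLaw, (show MeasurableSet {p : ℝ × X | ¬ p.1 = 0} from hS.compl)]

end PathLaw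

section Events

variable {X : Type*}

/-- The event that the `n`-th jump leads to `x` and happens up to time `t` (jump `0` is the start
of the process). -/
def arrivalSet (n : ℕ) (t : ℝ) (x : X) : Set (ℕ → ℝ × X) := {ω | ω n ∈ Iic t ×ˢ {x}}

/-- The event that at time `t` the process is in `x` and has jumped exactly `n` times. -/
def staySet (n : ℕ) (t : ℝ) (x : X) : Set (ℕ → ℝ × X) :=
  {ω | ω n ∈ Iic t ×ˢ {x} ∧ ω (n + 1) ∈ Ioi t ×ˢ univ}

/-- The event that the jump number `n + 1` goes from `x` to `y` and happens up to time `t`. -/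
def jumpSet (n : ℕ) (t : ℝ) (x y : X) : Set (ℕ → ℝ × X) :=
  {ω | ω n ∈ univ ×ˢ {x} ∧ ω (n + 1) ∈ Iic t ×ˢ {y}}

lemma arrivalSet_succ (n : ℕ) (t : ℝ) (y : X) :
    arrivalSet (n + 1) t y = ⋃ x, jumpSet n t x y := by
  ext ω
  simp [arrivalSet, jumpSet]

lemma disjoint_jumpSet_of_source_ne (n : ℕ) (t : ℝ) (y : X) {x x' : X} (h : x ≠ x') :
    Disjoint (jumpSet n t x y) (jumpSet n t x' y) :=
  Set.disjoint_left.2 fun _ hω hω' => h (hω.1.2.symm.trans hω'.1.2)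

lemma disjoint_jumpSet_of_target_ne (n : ℕ) (t : ℝ) (x : X) {y y' : X} (h : y ≠ y') :
    Disjoint (jumpSet n t x y) (jumpSet n t x y') :=
  Set.disjoint_left.2 fun _ hω hω' => h (hω.2.2.symm.trans hω'.2.2)

lemma disjoint_staySet_jumpSet (n : ℕ) (t : ℝ) (x y : X) :
    Disjoint (staySet n t x) (jumpSet n t x y) :=
  Set.disjoint_left.2 fun _ hω hω' => not_lt.2 (mem_Iic.1 hω'.2.1) hω.2.1

lemma mem_arrivalSet_iff {n : ℕ} {t : ℝ} {x : X} {ω : ℕ → ℝ × X}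
    (hω : StrictMono fun n => (ω n).1) :
    ω ∈ arrivalSet n t x ↔ ω ∈ staySet n t x ∪ ⋃ y, jumpSet n t x y := by
  have := hω (Nat.lt_succ_self n)
  simp only [arrivalSet, staySet, jumpSet, mem_union, mem_iUnion, mem_ofPred_eq, mem_prod, mem_Iic,
    mem_Ioi, mem_singleton_iff, mem_univ, and_true, true_and, exists_and_left]
  grind

lemma eq_of_mem_staySet {m n : ℕ} {t : ℝ} {x y : X} {ω : ℕ → ℝ × X}
    (hω : StrictMono fun n => (ω n).1) (hm : ω ∈ staySet m t x) (hn : ω ∈ staySet n t y) :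
    m = n := by
  have hmn : m < n + 1 := hω.lt_iff_lt.1 (lt_of_le_of_lt hm.1.1 hn.2.1)
  have hnm : n < m + 1 := hω.lt_iff_lt.1 (lt_of_le_of_lt hn.1.1 hm.2.1)
  lia

lemma stateAt_eq_some_iff {t : ℝ} {x : X} {ω : ℕ → ℝ × X} (hω : StrictMono fun n => (ω n).1) :
    stateAt t ω = some x ↔ ω ∈ ⋃ n, staySet n t x := by
  classical
  have hmem (n : ℕ) : ((ω n).1 ≤ t ∧ t < (ω (n + 1)).1) ↔ ω ∈ staySet n t (ω n).2 := by
    simp [staySet]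
  rw [mem_iUnion, stateAt]
  constructor
  · intro h
    split_ifs at h with hex
    exact ⟨Nat.find hex, Option.some.inj h ▸ (hmem _).1 (Nat.find_spec hex)⟩
  · rintro ⟨n, hn⟩
    have hex : ∃ n, (ω n).1 ≤ t ∧ t < (ω (n + 1)).1 := ⟨n, hn.1.1, hn.2.1⟩
    rw [dif_pos hex, eq_of_mem_staySet hω ((hmem _).1 (Nat.find_spec hex)) hn]
    exact congrArg some hn.1.2

variable [MeasurableSpace X] [MeasurableSingletonClass X]

lemma measurableSet_staySet (n : ℕ) (t : ℝ) (x : X) : MeasurableSet (staySet n t x) :=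
  (measurable_pi_apply n (measurableSet_Iic.prod (measurableSet_singleton x))).inter
    (measurable_pi_apply (n + 1) (measurableSet_Ioi.prod MeasurableSet.univ))

lemma measurableSet_jumpSet (n : ℕ) (t : ℝ) (x y : X) : MeasurableSet (jumpSet n t x y) :=
  (measurable_pi_apply n (MeasurableSet.univ.prod (measurableSet_singleton x))).inter
    (measurable_pi_apply (n + 1) (measurableSet_Iic.prod (measurableSet_singleton y)))

end Events

section Marginal

variable {X : Type*} [Fintype X] [MeasurableSpace X] [MeasurableSingletonClass X]
  (R : JumpRates X) {ν : X → ℝ}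

lemma pathLaw_staySet (hν : ν ∈ stdSimplex ℝ X) (n : ℕ) (t : ℝ) (x : X) :
    R.pathLaw ν (staySet n t x) = ∫⁻ ω, R.stayWeight t x (ω n) ∂(R.pathLaw ν) := by
  rw [staySet, R.pathLaw_eval_mem_and_succ_mem hν n
    (measurableSet_Iic.prod (measurableSet_singleton x))
    (measurableSet_Ioi.prod MeasurableSet.univ)]
  refine lintegral_congr fun ω => congrFun (indicator_congr ?_) (ω n)
  rintro p ⟨hpt, rfl⟩
  exact R.jumpKernel_Ioi_prod_univ hpt

lemma measurable_pathLaw_staySet (hν : ν ∈ stdSimplex ℝ X) (n : ℕ) (x : X) :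
    Measurable fun t => R.pathLaw ν (staySet n t x) := by
  have := R.isProbabilityMeasure_pathLaw hν
  simp_rw [R.pathLaw_staySet hν]
  exact ((R.measurable_stayWeight_uncurry x).comp
    (by fun_prop : Measurable fun z : ℝ × (ℕ → ℝ × X) => (z.1, z.2 n))).lintegral_prod_right'

lemma pathLaw_jumpSet (hν : ν ∈ stdSimplex ℝ X) (n : ℕ) (t : ℝ) (x y : X) :
    R.pathLaw ν (jumpSet n t x y) =
      ∫⁻ u in Iic t, ENNReal.ofReal (R.rate u x y) * R.pathLaw ν (staySet n u x) := by
  have := R.isProbabilityMeasure_pathLaw hν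
  have hm : Measurable fun z : ℝ × (ℕ → ℝ × X) =>
      ENNReal.ofReal (R.rate z.1 x y) * R.stayWeight z.1 x (z.2 n) :=
    ((R.measurable_rate x y).comp measurable_fst).ennreal_ofReal.mul
      ((R.measurable_stayWeight_uncurry x).comp
        (by fun_prop : Measurable fun z : ℝ × (ℕ → ℝ × X) => (z.1, z.2 n)))
  simp_rw [R.pathLaw_staySet hν, ← lintegral_const_mul' _ _ ENNReal.ofReal_ne_top]
  rw [lintegral_lintegral_swap hm.aemeasurable, jumpSet, R.pathLaw_eval_mem_and_succ_mem hν n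
    (MeasurableSet.univ.prod (measurableSet_singleton x))
    (measurableSet_Iic.prod (measurableSet_singleton y))]
  refine lintegral_congr fun ω => ?_
  by_cases hω : (ω n).2 = x
  · rw [indicator_of_mem (show ω n ∈ univ ×ˢ {x} from ⟨mem_univ _, hω⟩),
      jumpKernel_Iic_prod_singleton, hω]
  · rw [indicator_of_notMem fun h => hω h.2]
    simp [stayWeight, hω]

lemma pathLaw_stateAt (hν : ν ∈ stdSimplex ℝ X) (t : ℝ) (x : X) :
    R.pathLaw ν {ω | stateAt t ω = some x} = ∑' n, R.pathLaw ν (staySet n t x) := by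
  have hmono := R.ae_strictMono_jumpTime hν
  have heq : {ω | stateAt t ω = some x} =ᵐ[R.pathLaw ν] ⋃ n, staySet n t x :=
    Filter.eventuallyEq_set.2 (hmono.mono fun ω hω => stateAt_eq_some_iff hω)
  rw [measure_congr heq,
    measure_iUnion₀ _ fun n => (measurableSet_staySet n t x).nullMeasurableSet]
  exact fun m n hmn => measure_mono_null
    (fun ω hω hω' => hmn (eq_of_mem_staySet hω' hω.1 hω.2)) (ae_iff.1 hmono)

lemma pathLaw_arrivalSet_zero (hν : ν ∈ stdSimplex ℝ X) {t : ℝ} (ht : 0 ≤ t) (x : X) :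
    R.pathLaw ν (arrivalSet 0 t x) = ENNReal.ofReal (ν x) := by
  classical
  have hS : MeasurableSet (Iic t ×ˢ ({x} : Set X)) :=
    measurableSet_Iic.prod (measurableSet_singleton x)
  refine (Measure.map_apply (measurable_pi_apply 0) hS).symm.trans ?_
  rw [R.map_eval_zero_pathLaw hν]
  simp [startLaw, hS, indicator_apply, ht]

lemma pathLaw_arrivalSet_succ (ν : X → ℝ) (n : ℕ) (t : ℝ) (y : X) :
    R.pathLaw ν (arrivalSet (n + 1) t y) = ∑ x, R.pathLaw ν (jumpSet n t x y) := by
  rw [arrivalSet_succ, measure_iUnion (fun _ _ => disjoint_jumpSet_of_source_ne n t y)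
    fun x => measurableSet_jumpSet n t x y, tsum_fintype]

lemma pathLaw_arrivalSet (hν : ν ∈ stdSimplex ℝ X) (n : ℕ) (t : ℝ) (x : X) :
    R.pathLaw ν (arrivalSet n t x) =
      R.pathLaw ν (staySet n t x) + ∑ y, R.pathLaw ν (jumpSet n t x y) := by
  have heq : arrivalSet n t x =ᵐ[R.pathLaw ν] (staySet n t x ∪ ⋃ y, jumpSet n t x y : Set _) :=
    Filter.eventuallyEq_set.2
      ((R.ae_strictMono_jumpTime hν).mono fun ω hω => mem_arrivalSet_iff hω)
  rw [measure_congr heq, measure_union'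
    (disjoint_iUnion_right.2 fun y => disjoint_staySet_jumpSet n t x y)
    (measurableSet_staySet n t x), measure_iUnion (fun _ _ => disjoint_jumpSet_of_target_ne n t x)
    fun y => measurableSet_jumpSet n t x y, tsum_fintype]

lemma pathLaw_staySet_of_neg (hν : ν ∈ stdSimplex ℝ X) (n : ℕ) {t : ℝ} (ht : t < 0) (x : X) :
    R.pathLaw ν (staySet n t x) = 0 := by
  rw [measure_eq_zero_iff_ae_notMem]
  filter_upwards [R.ae_strictMono_jumpTime hν, R.ae_jumpTime_zero hν] with ω hmono hzero hω
  have hle : (ω 0).1 ≤ (ω n).1 := hmono.monotone (Nat.zero_le n)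
  exact not_le.2 ht (hzero ▸ hle.trans hω.1.1)

lemma marginal_nonneg (ν : X → ℝ) (t : ℝ) (x : X) : 0 ≤ R.marginal ν t x :=
  measureReal_nonneg

lemma marginal_le_one (hν : ν ∈ stdSimplex ℝ X) (t : ℝ) (x : X) : R.marginal ν t x ≤ 1 := by
  have := R.isProbabilityMeasure_pathLaw hν
  exact measureReal_le_one

lemma ofReal_marginal (hν : ν ∈ stdSimplex ℝ X) (t : ℝ) (x : X) :
    ENNReal.ofReal (R.marginal ν t x) = ∑' n, R.pathLaw ν (staySet n t x) := by
  have := R.isProbabilityMeasure_pathLaw hν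
  rw [marginal, ofReal_measureReal, R.pathLaw_stateAt hν]

lemma marginal_of_neg (hν : ν ∈ stdSimplex ℝ X) {t : ℝ} (ht : t < 0) (x : X) :
    R.marginal ν t x = 0 := by
  have h := R.ofReal_marginal hν t x
  simp only [R.pathLaw_staySet_of_neg hν _ ht, tsum_zero, ENNReal.ofReal_eq_zero] at h
  exact le_antisymm h (R.marginal_nonneg ν t x)

lemma measurable_marginal (hν : ν ∈ stdSimplex ℝ X) : Measurable (R.marginal ν) := by
  refine measurable_pi_lambda _ fun x => ?_
  have h (t : ℝ) : R.marginal ν t x = (∑' n, R.pathLaw ν (staySet n t x)).toReal := by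
    rw [← R.ofReal_marginal hν, ENNReal.toReal_ofReal (R.marginal_nonneg ν t x)]
  simp_rw [h]
  exact (Measurable.tsum fun n => R.measurable_pathLaw_staySet hν n x).ennreal_toReal

lemma intervalIntegrable_marginal_mul_rate (hν : ν ∈ stdSimplex ℝ X) (x y : X) (a b : ℝ) :
    IntervalIntegrable (fun u => R.marginal ν u x * R.rate u x y) volume a b := by
  obtain ⟨C, hC⟩ := R.rate_bounded
  have hm : Measurable fun u => R.marginal ν u x * R.rate u x y :=
    ((measurable_pi_apply x).comp (R.measurable_marginal hν)).mul (R.measurable_rate x y)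
  refine (intervalIntegrable_const (c := 1 * C)).mono_fun' hm.aestronglyMeasurable
    (Filter.Eventually.of_forall fun u => ?_)
  refine (Real.norm_of_nonneg
    (mul_nonneg (R.marginal_nonneg ν u x) (R.rate_nonneg u x y))).trans_le ?_
  exact mul_le_mul (R.marginal_le_one hν u x) (hC u x y) (R.rate_nonneg u x y) zero_le_one

lemma tsum_pathLaw_jumpSet (hν : ν ∈ stdSimplex ℝ X) {t : ℝ} (ht : 0 ≤ t) (x y : X) :
    ∑' n, R.pathLaw ν (jumpSet n t x y) =
      ENNReal.ofReal (∫ u in (0 : ℝ)..t, R.marginal ν u x * R.rate u x y) := by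
  have hnonneg (u : ℝ) : 0 ≤ R.marginal ν u x * R.rate u x y :=
    mul_nonneg (R.marginal_nonneg ν u x) (R.rate_nonneg u x y)
  have hint := (intervalIntegrable_iff_integrableOn_Ioc_of_le ht).1
    (R.intervalIntegrable_marginal_mul_rate hν x y 0 t)
  have hm (n : ℕ) : Measurable fun u =>
      ENNReal.ofReal (R.rate u x y) * R.pathLaw ν (staySet n u x) :=
    (R.measurable_rate x y).ennreal_ofReal.mul (R.measurable_pathLaw_staySet hν n x)
  simp_rw [R.pathLaw_jumpSet hν]
  rw [intervalIntegral.integral_of_le ht, ofReal_integral_eq_lintegral_ofReal hint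
      (Filter.Eventually.of_forall hnonneg), restrict_Ioc_eq_restrict_Icc,
    ← lintegral_tsum fun n => (hm n).aemeasurable,
    ← lintegral_indicator measurableSet_Iic, ← lintegral_indicator measurableSet_Icc]
  refine lintegral_congr fun u => ?_
  simp_rw [ENNReal.tsum_mul_left, ← R.ofReal_marginal hν, indicator_apply, mem_Iic, mem_Icc]
  rcases lt_or_ge u 0 with hu | hu
  · simp [R.marginal_of_neg hν hu]
  · simp [hu, mul_comm (R.marginal ν u x), ENNReal.ofReal_mul (R.rate_nonneg u x y)]

lemma marginal_add_outflow_eq_add_inflow (hν : ν ∈ stdSimplex ℝ X) {t : ℝ} (ht : 0 ≤ t) (y : X) :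
    R.marginal ν t y + ∑ z, ∫ u in (0 : ℝ)..t, R.marginal ν u y * R.rate u y z =
      ν y + ∑ x, ∫ u in (0 : ℝ)..t, R.marginal ν u x * R.rate u x y := by
  have hflow (x z : X) : 0 ≤ ∫ u in (0 : ℝ)..t, R.marginal ν u x * R.rate u x z :=
    intervalIntegral.integral_nonneg ht fun u _ =>
      mul_nonneg (R.marginal_nonneg ν u x) (R.rate_nonneg u x z)
  have hout : ∑' n, R.pathLaw ν (arrivalSet n t y) = ENNReal.ofReal (R.marginal ν t y) +
      ∑ z, ENNReal.ofReal (∫ u in (0 : ℝ)..t, R.marginal ν u y * R.rate u y z) := by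
    simp_rw [R.pathLaw_arrivalSet hν, ← R.tsum_pathLaw_jumpSet hν ht, R.ofReal_marginal hν]
    rw [ENNReal.tsum_add, Summable.tsum_finsetSum fun _ _ => ENNReal.summable]
  have hin : ∑' n, R.pathLaw ν (arrivalSet n t y) = ENNReal.ofReal (ν y) +
      ∑ x, ENNReal.ofReal (∫ u in (0 : ℝ)..t, R.marginal ν u x * R.rate u x y) := by
    rw [tsum_eq_zero_add' ENNReal.summable, R.pathLaw_arrivalSet_zero hν ht]
    simp_rw [R.pathLaw_arrivalSet_succ, ← R.tsum_pathLaw_jumpSet hν ht]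
    rw [Summable.tsum_finsetSum fun _ _ => ENNReal.summable]
  have hbalance := hout.symm.trans hin
  rw [← ENNReal.ofReal_sum_of_nonneg fun z _ => hflow y z,
    ← ENNReal.ofReal_sum_of_nonneg fun x _ => hflow x y,
    ← ENNReal.ofReal_add (R.marginal_nonneg ν t y) (Finset.sum_nonneg fun z _ => hflow y z),
    ← ENNReal.ofReal_add (hν.1 y) (Finset.sum_nonneg fun x _ => hflow x y)] at hbalance
  exact (ENNReal.ofReal_eq_ofReal_iff
    (add_nonneg (R.marginal_nonneg ν t y) (Finset.sum_nonneg fun z _ => hflow y z))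
    (add_nonneg (hν.1 y) (Finset.sum_nonneg fun x _ => hflow x y))).1 hbalance

end Marginal

end JumpRates

/-! ### Linear equations with time-dependent coefficients -/

section AbsolutelyContinuous

open Filter Topology AbsolutelyContinuousOnInterval

variable {a b : ℝ}

lemma absolutelyContinuousOnInterval_of_dist_le {Y Z : Type*} [PseudoMetricSpace Y]
    [PseudoMetricSpace Z] {f : ℝ → Y} {g : ℝ → Z} (hg : AbsolutelyContinuousOnInterval g a b)
    (C : ℝ) (h : ∀ x ∈ uIcc a b, ∀ y ∈ uIcc a b, dist (f x) (f y) ≤ C * dist (g x) (g y)) :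
    AbsolutelyContinuousOnInterval f a b := by
  refine squeeze_zero' (Eventually.of_forall fun I => Finset.sum_nonneg fun i _ => dist_nonneg)
    ?_ (by simpa using Tendsto.const_mul C hg)
  filter_upwards [mem_inf_of_right (mem_principal_self (disjWithin a b))] with I hI
  rw [Finset.mul_sum]
  exact Finset.sum_le_sum fun i hi => h _ (hI.1 i hi).1 _ (hI.1 i hi).2

lemma absolutelyContinuousOnInterval_prodMk {Y Z : Type*} [PseudoMetricSpace Y]
    [PseudoMetricSpace Z] {f : ℝ → Y} {g : ℝ → Z} (hf : AbsolutelyContinuousOnInterval f a b)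
    (hg : AbsolutelyContinuousOnInterval g a b) :
    AbsolutelyContinuousOnInterval (fun x => (f x, g x)) a b := by
  refine squeeze_zero (fun I => Finset.sum_nonneg fun i _ => dist_nonneg) (fun I => ?_)
    (by simpa using Tendsto.add hf hg)
  rw [← Finset.sum_add_distrib]
  exact Finset.sum_le_sum fun i _ =>
    max_le (le_add_of_nonneg_right dist_nonneg) (le_add_of_nonneg_left dist_nonneg)

variable {E F : Type*} [NormedAddCommGroup E] [NormedSpace ℝ E] [NormedAddCommGroup F]
  [NormedSpace ℝ F]

lemma intervalIntegrable_clm_apply {Φ : ℝ → E →L[ℝ] F} (hΦ : Continuous Φ) {f : ℝ → E}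
    (hf : IntervalIntegrable f volume a b) :
    IntervalIntegrable (fun s => Φ s (f s)) volume a b := by
  obtain ⟨B, hB⟩ := isCompact_uIcc.exists_bound_of_continuousOn (hΦ.continuousOn (s := uIcc a b))
  refine (hf.norm.const_mul B).mono_fun
    ((ContinuousLinearMap.apply ℝ F).flip.aestronglyMeasurable_comp₂
      hΦ.aestronglyMeasurable hf.aestronglyMeasurable_restrict_uIoc) ?_
  refine (ae_restrict_iff' measurableSet_uIoc).2 (Filter.Eventually.of_forall fun s hs => ?_)
  exact ((Φ s).le_of_opNorm_le (hB s (uIoc_subset_uIcc hs)) _).trans (le_abs_self _)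

lemma absolutelyContinuousOnInterval_clm_apply {Φ : ℝ → E →L[ℝ] F} {f : ℝ → E}
    (hΦ : AbsolutelyContinuousOnInterval Φ a b) (hf : AbsolutelyContinuousOnInterval f a b) :
    AbsolutelyContinuousOnInterval (fun x => Φ x (f x)) a b := by
  obtain ⟨B, hB⟩ := hΦ.exists_bound
  obtain ⟨D, hD⟩ := hf.exists_bound
  refine absolutelyContinuousOnInterval_of_dist_le (absolutelyContinuousOnInterval_prodMk hΦ hf)
    (D + B) fun x hx y hy => ?_
  calc dist (Φ x (f x)) (Φ y (f y))
      ≤ dist (Φ x (f x)) (Φ y (f x)) + dist (Φ y (f x)) (Φ y (f y)) := dist_triangle _ _ _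
    _ = ‖(Φ x - Φ y) (f x)‖ + ‖Φ y (f x - f y)‖ := by
        simp only [dist_eq_norm, sub_apply, map_sub]
    _ ≤ dist (Φ x) (Φ y) * D + B * dist (f x) (f y) := by
        rw [dist_eq_norm, dist_eq_norm]
        exact add_le_add ((Φ x - Φ y).le_opNorm_of_le (hD x hx)) ((Φ y).le_of_opNorm_le (hB y hy) _)
    _ ≤ (D + B) * dist (Φ x, f x) (Φ y, f y) := by
        rw [add_mul, mul_comm D, Prod.dist_eq]
        have hD₀ := (norm_nonneg _).trans (hD x hx)
        have hB₀ := (norm_nonneg _).trans (hB x hx)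
        gcongr
        exacts [le_max_left _ _, le_max_right _ _]

lemma absolutelyContinuousOnInterval_intervalIntegral {f : ℝ → E}
    (hf : IntervalIntegrable f volume a b) :
    AbsolutelyContinuousOnInterval (fun x => ∫ u in a..x, f u) a b := by
  refine absolutelyContinuousOnInterval_of_dist_le
    (hf.norm.absolutelyContinuousOnInterval_intervalIntegral left_mem_uIcc) 1 fun x hx y hy => ?_
  have hint : ∀ z ∈ uIcc a b, IntervalIntegrable f volume a z := fun z hz =>
    hf.mono_set (uIcc_subset_uIcc_left hz)
  rw [one_mul, dist_eq_norm, Real.dist_eq,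
    intervalIntegral.integral_interval_sub_left (hint x hx) (hint y hy),
    intervalIntegral.integral_interval_sub_left (hint x hx).norm (hint y hy).norm]
  exact intervalIntegral.norm_integral_le_abs_integral_norm

lemma intervalIntegral_eq_sub_of_absolutelyContinuousOnInterval [CompleteSpace E] {f f' : ℝ → E}
    (hf : AbsolutelyContinuousOnInterval f a b)
    (hderiv : ∀ᵐ x, x ∈ uIcc a b → HasDerivAt f (f' x) x)
    (hint : IntervalIntegrable f' volume a b) : ∫ x in a..b, f' x = f b - f a := by
  have hconst : ∀ᵐ x, x ∈ uIcc a b → HasDerivAt (fun y => f y - ∫ u in a..y, f' u) 0 x := by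
    filter_upwards [hderiv, hint.ae_hasDerivAt_integral] with x h₁ h₂ hx
    exact ((h₁ hx).sub (h₂ hx a left_mem_uIcc)).congr_deriv (sub_self _)
  obtain ⟨c, hc⟩ := AbsolutelyContinuousOnInterval.const_of_ae_hasDerivAt_zero
    (hf.sub (absolutelyContinuousOnInterval_intervalIntegral hint)) hconst
  have ha := hc a left_mem_uIcc
  have hb := hc b right_mem_uIcc
  simp only [Pi.sub_apply, intervalIntegral.integral_same, sub_zero] at ha hb
  rw [ha, ← hb, sub_sub_cancel]

end AbsolutelyContinuous

section ExpSemigroup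

variable {E : Type*} [NormedAddCommGroup E] [NormedSpace ℝ E] [CompleteSpace E]

lemma exp_add_smul_apply (A : E →L[ℝ] E) (s t : ℝ) (v : E) :
    NormedSpace.exp ((s + t) • A) v = NormedSpace.exp (s • A) (NormedSpace.exp (t • A) v) := by
  let _ : NormedAlgebra ℚ (E →L[ℝ] E) := NormedAlgebra.restrictScalars ℚ ℝ (E →L[ℝ] E)
  rw [add_smul, NormedSpace.exp_add_of_commute ((Commute.refl A).smul_left s |>.smul_right t)]
  rfl

lemma continuous_exp_smul (A : E →L[ℝ] E) : Continuous fun s : ℝ => NormedSpace.exp (s • A) :=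
  continuous_iff_continuousAt.2 fun s => (hasDerivAt_exp_smul_const A s).continuousAt

lemma hasDerivAt_exp_sub_smul (A : E →L[ℝ] E) (t s : ℝ) :
    HasDerivAt (fun s : ℝ => NormedSpace.exp ((t - s) • A))
      (-(NormedSpace.exp ((t - s) • A) * A)) s := by
  have h := (hasDerivAt_exp_smul_const (𝕂 := ℝ) A (t - s)).scomp s
    ((hasDerivAt_id s).const_sub t)
  exact h.congr_deriv (by simp)

lemma absolutelyContinuousOnInterval_exp_sub_smul (A : E →L[ℝ] E) (t a b : ℝ) :
    AbsolutelyContinuousOnInterval (fun s : ℝ => NormedSpace.exp ((t - s) • A)) a b := by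
  have hcont : Continuous fun s : ℝ => NormedSpace.exp ((t - s) • A) :=
    (continuous_exp_smul A).comp (continuous_const.sub continuous_id)
  refine (contDiff_one_iff_deriv.2 ⟨fun s => (hasDerivAt_exp_sub_smul A t s).differentiableAt,
    ?_⟩).contDiffOn.absolutelyContinuousOnInterval
  rw [funext fun s => (hasDerivAt_exp_sub_smul A t s).deriv]
  exact (hcont.mul continuous_const).neg

/-- Variation of constants, for `P' = A P + (h - A P)` with `P` only absolutely continuous. -/
theorem duhamel (A : E →L[ℝ] E) {h P : ℝ → E} {t : ℝ} (ht : 0 ≤ t)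
    (hh : IntervalIntegrable h volume 0 t)
    (hP : ∀ s ∈ Icc 0 t, P s = P 0 + ∫ u in (0 : ℝ)..s, h u) :
    P t = NormedSpace.exp (t • A) (P 0) +
      ∫ s in (0 : ℝ)..t, NormedSpace.exp ((t - s) • A) (h s - A (P s)) := by
  set Φ : ℝ → E →L[ℝ] E := fun s => NormedSpace.exp ((t - s) • A) with hΦ
  set Q : ℝ → E := fun s => P 0 + ∫ u in (0 : ℝ)..s, h u with hQ
  have hPQ : EqOn P Q (uIcc 0 t) := by rwa [uIcc_of_le ht]
  have hΦc : Continuous Φ := (continuous_exp_smul A).comp (continuous_const.sub continuous_id)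
  have hQac : AbsolutelyContinuousOnInterval Q 0 t :=
    absolutelyContinuousOnInterval_of_dist_le
      (absolutelyContinuousOnInterval_intervalIntegral hh) 1 fun x _ y _ => by simp [hQ]
  have hderiv : ∀ᵐ s, s ∈ uIcc 0 t →
      HasDerivAt (fun s => Φ s (Q s)) (Φ s (h s - A (Q s))) s := by
    filter_upwards [hh.ae_hasDerivAt_integral] with s hs hst
    refine ((hasDerivAt_exp_sub_smul A t s).clm_apply
      ((hs hst 0 left_mem_uIcc).const_add (P 0))).congr_deriv ?_
    simp only [hΦ, hQ, _root_.neg_apply, mul_apply_eq_comp, map_sub]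
    abel
  have hint : IntervalIntegrable (fun s => Φ s (h s - A (Q s))) volume 0 t :=
    intervalIntegrable_clm_apply hΦc
      (hh.sub (A.continuous.comp_continuousOn hQac.continuousOn).intervalIntegrable)
  have hftc := intervalIntegral_eq_sub_of_absolutelyContinuousOnInterval
    (absolutelyContinuousOnInterval_clm_apply
      (absolutelyContinuousOnInterval_exp_sub_smul A t 0 t) hQac) hderiv hint
  calc P t = NormedSpace.exp (t • A) (P 0) + ∫ s in (0 : ℝ)..t, Φ s (h s - A (Q s)) := by
        rw [hftc, hPQ right_mem_uIcc]
        simp [hQ]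
    _ = _ := by
        rw [intervalIntegral.integral_congr fun s hs =>
          show Φ s (h s - A (Q s)) = Φ s (h s - A (P s)) by rw [hPQ hs]]

end ExpSemigroup

lemma eq_zero_of_norm_le_mul_integral_norm {E : Type*} [NormedAddCommGroup E] {f : ℝ → E}
    {C t : ℝ} (hf : ContinuousOn f (Icc 0 t))
    (h : ∀ s ∈ Icc 0 t, ‖f s‖ ≤ C * ∫ u in (0 : ℝ)..s, ‖f u‖) (ht : 0 ≤ t) : f t = 0 := by
  set F : ℝ → ℝ := fun s => ∫ u in (0 : ℝ)..s, ‖f u‖ with hF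
  have hcont : ContinuousOn F (Icc 0 t) := by
    rw [← uIcc_of_le ht] at hf ⊢
    exact intervalIntegral.continuousOn_primitive_interval
      (hf.norm.integrableOn_compact isCompact_uIcc)
  have hderiv : ∀ s ∈ Ico 0 t, HasDerivWithinAt F ‖f s‖ (Ici s) s := fun s hs => by
    have hsub : Ioo s t ⊆ Icc 0 t := fun u hu => ⟨hs.1.trans hu.1.le, hu.2.le⟩
    refine intervalIntegral.integral_hasDerivWithinAt_right (t := Ioi s)
      ((hf.norm.mono (Icc_subset_Icc_right hs.2.le)).intervalIntegrable_of_Icc hs.1)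
      ⟨Ioo s t, Ioo_mem_nhdsGT hs.2, ((hf.norm.mono hsub).aestronglyMeasurable measurableSet_Ioo)⟩
      ((hf.norm s (Ico_subset_Icc_self hs)).mono_of_mem_nhdsWithin
        (Filter.mem_of_superset (Ioo_mem_nhdsGT hs.2) hsub))
  have hF₀ : F t = 0 := by
    refine eq_zero_of_abs_deriv_le_mul_abs_self_of_eq_zero_right (K := C) hcont hderiv
      (by simp [hF]) (fun s hs => ?_) t ⟨ht, le_rfl⟩
    rw [norm_norm, Real.norm_of_nonneg
      (intervalIntegral.integral_nonneg hs.1 fun u _ => norm_nonneg _)]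
    exact h s (Ico_subset_Icc_self hs)
  exact norm_le_zero_iff.1 ((h t ⟨ht, le_rfl⟩).trans_eq (by exact mul_eq_zero_of_right C hF₀))

namespace LinearODE

variable {E : Type*} [NormedAddCommGroup E] [NormedSpace ℝ E]

/-- The solutions on `[0, ∞)` of the linear equation `p' = L p` with time-dependent coefficients,
in integrated form, since `L` is only measurable in time. -/
def solutions (L : ℝ → E →L[ℝ] E) : Submodule ℝ (ℝ → E) where
  carrier := {p | ∀ t, 0 ≤ t → IntervalIntegrable (fun u => L u (p u)) volume 0 t ∧
    p t = p 0 + ∫ u in (0 : ℝ)..t, L u (p u)}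
  zero_mem' t _ := by simp
  add_mem' {p q} hp hq t ht := by
    obtain ⟨hpi, hpt⟩ := hp t ht
    obtain ⟨hqi, hqt⟩ := hq t ht
    simp only [Pi.add_apply, map_add]
    refine ⟨hpi.add hqi, ?_⟩
    rw [intervalIntegral.integral_add hpi hqi, hpt, hqt]
    abel
  smul_mem' c p hp t ht := by
    obtain ⟨hpi, hpt⟩ := hp t ht
    simp only [Pi.smul_apply, map_smul]
    refine ⟨hpi.smul c, ?_⟩
    rw [intervalIntegral.integral_smul, ← smul_add, ← hpt]

variable {L : ℝ → E →L[ℝ] E} {p q : ℝ → E} {t T : ℝ}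

lemma intervalIntegrable_of_mem_solutions (hp : p ∈ solutions L) (ht : 0 ≤ t) :
    IntervalIntegrable (fun u => L u (p u)) volume 0 t :=
  (hp t ht).1

lemma eq_add_integral_of_mem_solutions (hp : p ∈ solutions L) (ht : 0 ≤ t) :
    p t = p 0 + ∫ u in (0 : ℝ)..t, L u (p u) :=
  (hp t ht).2

lemma continuousOn_of_mem_solutions (hp : p ∈ solutions L) (ht : 0 ≤ t) :
    ContinuousOn p (Icc 0 t) := by
  have hint := intervalIntegrable_of_mem_solutions hp ht
  rw [← uIcc_of_le ht]
  refine ((absolutelyContinuousOnInterval_intervalIntegral hint).continuousOn.const_add (p 0)).congr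
    fun s hs => eq_add_integral_of_mem_solutions hp ?_
  rw [uIcc_of_le ht] at hs
  exact hs.1

lemma eq_of_mem_solutions {C : ℝ} (hL : ∀ t, ‖L t‖ ≤ C) (hp : p ∈ solutions L)
    (hq : q ∈ solutions L) (h₀ : p 0 = q 0) (ht : 0 ≤ t) : p t = q t := by
  have hmem : p - q ∈ solutions L := (solutions L).sub_mem hp hq
  refine sub_eq_zero.1 (eq_zero_of_norm_le_mul_integral_norm (C := C) (f := p - q)
    (continuousOn_of_mem_solutions hmem ht) (fun s hs => ?_) ht)
  have hint : IntervalIntegrable (p - q) volume 0 s :=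
    (continuousOn_of_mem_solutions hmem hs.1).intervalIntegrable_of_Icc hs.1
  rw [eq_add_integral_of_mem_solutions hmem hs.1, Pi.sub_apply, h₀, sub_self, zero_add,
    ← intervalIntegral.integral_const_mul]
  exact intervalIntegral.norm_integral_le_of_norm_le hs.1
    (Filter.Eventually.of_forall fun u _ => (L u).le_of_opNorm_le (hL u) _) (hint.norm.const_mul C)

lemma comp_add_mem_solutions (hp : p ∈ solutions L) (hT : 0 ≤ T) (hL : Function.Periodic L T) :
    (fun t => p (t + T)) ∈ solutions L := by
  intro t ht
  have hTt := add_nonneg ht hT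
  have hint : IntervalIntegrable (fun u => L u (p u)) volume T (t + T) :=
    (intervalIntegrable_of_mem_solutions hp hT).symm.trans
      (intervalIntegrable_of_mem_solutions hp hTt)
  constructor
  · simpa [hL _] using hint.comp_add_right T
  · have h := intervalIntegral.integral_comp_add_right (fun u => L u (p u)) T (a := 0) (b := t)
    simp only [hL _, zero_add] at h
    simp only [zero_add]
    rw [h, eq_add_integral_of_mem_solutions hp hTt,
      eq_add_integral_of_mem_solutions hp hT, add_assoc,
      intervalIntegral.integral_add_adjacent_intervals
        (intervalIntegrable_of_mem_solutions hp hT) hint]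

end LinearODE

namespace MarkovChain

open LinearODE

variable {X : Type*} [Fintype X]

/-- The operator of the forward equation `∂ₜ p = forwardGen ρ p` with rates `ρ`. -/
noncomputable def forwardGen : (X → X → ℝ) →L[ℝ] (X → ℝ) →L[ℝ] (X → ℝ) :=
  (LinearMap.mk₂ ℝ (fun (ρ : X → X → ℝ) (v : X → ℝ) y => ∑ x, (v x * ρ x y - v y * ρ y x))
    (fun ρ σ v => by
      funext y
      simp only [Pi.add_apply, ← Finset.sum_add_distrib]
      exact Finset.sum_congr rfl fun x _ => by ring)
    (fun c ρ v => by
      funext y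
      simp only [Pi.smul_apply, smul_eq_mul, Finset.mul_sum]
      exact Finset.sum_congr rfl fun x _ => by ring)
    (fun ρ v w => by
      funext y
      simp only [Pi.add_apply, ← Finset.sum_add_distrib]
      exact Finset.sum_congr rfl fun x _ => by ring)
    fun c ρ v => by
      funext y
      simp only [Pi.smul_apply, smul_eq_mul, Finset.mul_sum]
      exact Finset.sum_congr rfl fun x _ => by ring).toContinuousBilinearMap

lemma forwardGen_apply (ρ : X → X → ℝ) (v : X → ℝ) (y : X) :
    forwardGen ρ v y = ∑ x, (v x * ρ x y - v y * ρ y x) := rfl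

lemma sum_forwardGen (ρ : X → X → ℝ) (v : X → ℝ) : ∑ y, forwardGen ρ v y = 0 := by
  simp only [forwardGen_apply, Finset.sum_sub_distrib]
  rw [Finset.sum_comm, sub_self]

lemma measurable_forwardGen {ρ : ℝ → X → X → ℝ} (hρ : Measurable ρ) {p : ℝ → X → ℝ}
    (hp : Measurable p) : Measurable fun t => forwardGen (ρ t) (p t) :=
  (forwardGen (X := X)).continuous₂.measurable.comp (hρ.prodMk hp)

lemma sum_eq_of_mem_solutions {ρ : ℝ → X → X → ℝ} {p : ℝ → X → ℝ}
    (hp : p ∈ solutions fun t => forwardGen (ρ t)) {t : ℝ} (ht : 0 ≤ t) :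
    ∑ y, p t y = ∑ y, p 0 y := by
  let S : (X → ℝ) →L[ℝ] ℝ := ∑ y, ContinuousLinearMap.proj y
  have hS : ∀ v, S v = ∑ y, v y := fun v => by simp [S]
  have h := congrArg S (eq_add_integral_of_mem_solutions hp ht)
  rw [map_add, ← S.intervalIntegral_comp_comm (intervalIntegrable_of_mem_solutions hp ht)] at h
  simpa [hS, sum_forwardGen] using h

end MarkovChain

namespace JumpRates

open MarkovChain LinearODE

variable {X : Type*} [Fintype X]

lemma measurable_rate_pi (R : JumpRates X) : Measurable R.rate :=
  measurable_pi_iff.2 fun x => measurable_pi_iff.2 fun y => R.measurable_rate x y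

lemma exists_norm_rate_le (R : JumpRates X) : ∃ C, ∀ t, ‖R.rate t‖ ≤ C := by
  obtain ⟨C, hC⟩ := R.rate_bounded
  refine ⟨|C|, fun t => (pi_norm_le_iff_of_nonneg (abs_nonneg C)).2 fun x =>
    (pi_norm_le_iff_of_nonneg (abs_nonneg C)).2 fun y => ?_⟩
  rw [Real.norm_of_nonneg (R.rate_nonneg t x y)]
  exact (hC t x y).trans (le_abs_self C)

/-- The solutions of the forward (Kolmogorov) equation of the process with rates `R`. -/
noncomputable abbrev forwardSolutions (R : JumpRates X) : Submodule ℝ (ℝ → X → ℝ) :=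
  solutions fun t => forwardGen (R.rate t)

lemma eq_of_mem_forwardSolutions (R : JumpRates X) {p q : ℝ → X → ℝ} (hp : p ∈ R.forwardSolutions)
    (hq : q ∈ R.forwardSolutions) (h₀ : p 0 = q 0) {t : ℝ} (ht : 0 ≤ t) : p t = q t := by
  obtain ⟨C, hC⟩ := R.exists_norm_rate_le
  exact eq_of_mem_solutions (fun t => forwardGen.le_opNorm_of_le (hC t)) hp hq h₀ ht

variable [MeasurableSpace X] [MeasurableSingletonClass X] (R : JumpRates X) {ν : X → ℝ}

lemma marginal_zero (hν : ν ∈ stdSimplex ℝ X) : R.marginal ν 0 = ν := by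
  funext y
  simpa using R.marginal_add_outflow_eq_add_inflow hν le_rfl y

lemma intervalIntegrable_forwardGen_marginal (hν : ν ∈ stdSimplex ℝ X) (y : X) (a b : ℝ) :
    IntervalIntegrable (fun u => forwardGen (R.rate u) (R.marginal ν u) y) volume a b := by
  simp only [forwardGen_apply, ← Finset.sum_fn]
  exact .sum _ fun x _ => (R.intervalIntegrable_marginal_mul_rate hν x y a b).sub
    (R.intervalIntegrable_marginal_mul_rate hν y x a b)

lemma marginal_eq_add_integral_forwardGen (hν : ν ∈ stdSimplex ℝ X) {t : ℝ} (ht : 0 ≤ t) (y : X) :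
    R.marginal ν t y =
      ν y + ∫ u in (0 : ℝ)..t, forwardGen (R.rate u) (R.marginal ν u) y := by
  have hflow (x y : X) := R.intervalIntegrable_marginal_mul_rate hν x y 0 t
  simp only [forwardGen_apply]
  rw [intervalIntegral.integral_finsetSum fun x _ => (hflow x y).sub (hflow y x),
    Finset.sum_congr rfl fun x _ => intervalIntegral.integral_sub (hflow x y) (hflow y x),
    Finset.sum_sub_distrib]
  linarith [R.marginal_add_outflow_eq_add_inflow hν ht y]

lemma marginal_mem_forwardSolutions (hν : ν ∈ stdSimplex ℝ X) :
    R.marginal ν ∈ R.forwardSolutions := by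
  intro t ht
  have hint (y : X) := R.intervalIntegrable_forwardGen_marginal hν y 0 t
  simp only [intervalIntegrable_iff_integrableOn_Ioc_of_le ht, IntegrableOn] at hint ⊢
  refine ⟨.of_eval hint, ?_⟩
  funext y
  rw [R.marginal_zero hν, Pi.add_apply, intervalIntegral.integral_of_le ht, eval_integral hint,
    ← intervalIntegral.integral_of_le ht]
  exact R.marginal_eq_add_integral_forwardGen hν ht y

lemma marginal_mem_stdSimplex (hν : ν ∈ stdSimplex ℝ X) {t : ℝ} (ht : 0 ≤ t) :
    R.marginal ν t ∈ stdSimplex ℝ X := by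
  refine ⟨fun x => R.marginal_nonneg ν t x, ?_⟩
  rw [sum_eq_of_mem_solutions (R.marginal_mem_forwardSolutions hν) ht, R.marginal_zero hν, hν.2]

lemma eq_sum_smul_marginal [DecidableEq X] {p : ℝ → X → ℝ} (hp : p ∈ R.forwardSolutions) {t : ℝ}
    (ht : 0 ≤ t) : p t = ∑ x, p 0 x • R.marginal (Pi.single x 1) t := by
  have hsum : ∑ x, p 0 x • R.marginal (Pi.single x 1) ∈ R.forwardSolutions :=
    Submodule.sum_smul_mem _ _ fun x _ =>
      R.marginal_mem_forwardSolutions (single_mem_stdSimplex ℝ x)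
  refine (R.eq_of_mem_forwardSolutions hp hsum ?_ ht).trans (Finset.sum_apply _ _ _)
  simp only [Finset.sum_apply, Pi.smul_apply, R.marginal_zero (single_mem_stdSimplex ℝ _)]
  exact pi_eq_sum_univ' _

end JumpRates

/-! ### Positive transition matrices -/

/-- The minimizer of the displacement `d x (f x)` is the fixed point. -/
lemma existsUnique_isFixedPt_of_forall_lt {Y : Type*} [TopologicalSpace Y] {K : Set Y}
    (hK : IsCompact K) (hne : K.Nonempty) {f : Y → Y} (hf : MapsTo f K K) {d : Y → Y → ℝ}
    (hd : ContinuousOn (fun x => d x (f x)) K)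
    (hlt : ∀ x ∈ K, ∀ y ∈ K, x ≠ y → d (f x) (f y) < d x y) :
    ∃! x, x ∈ K ∧ Function.IsFixedPt f x := by
  obtain ⟨x, hx, hmin⟩ := hK.exists_isMinOn hne hd
  have hfix : Function.IsFixedPt f x := by
    by_contra hne
    exact (hlt x hx (f x) (hf hx) (Ne.symm hne)).not_ge (isMinOn_iff.1 hmin _ (hf hx))
  refine ⟨x, ⟨hx, hfix⟩, fun y ⟨hy, hyf⟩ => ?_⟩
  by_contra hne
  have h := hlt y hy x hx hne
  rw [hyf.eq, hfix.eq] at h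
  exact h.false

section Stochastic

open Matrix

variable {X : Type*} [Fintype X] [DecidableEq X] {P : Matrix X X ℝ}

lemma vecMul_mem_stdSimplex (hP : P ∈ rowStochastic ℝ X) {ν : X → ℝ} (hν : ν ∈ stdSimplex ℝ X) :
    ν ᵥ* P ∈ stdSimplex ℝ X := by
  refine ⟨nonneg_vecMul_of_mem_rowStochastic hP hν.1, ?_⟩
  simpa [dotProduct_one] using
    vecMul_dotProduct_one_eq_one_rowStochastic hP (by rw [dotProduct_one, hν.2])

/-- Subtracting the constant `δ` from all entries of `P` does not change the action of `P` on
vectors of total mass zero. -/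
lemma sum_abs_vecMul_le (hP : P ∈ rowStochastic ℝ X) {δ : ℝ} (hδ : ∀ x y, δ ≤ P x y)
    {v : X → ℝ} (hv : ∑ x, v x = 0) :
    ∑ y, |(v ᵥ* P) y| ≤ (1 - Fintype.card X * δ) * ∑ x, |v x| := by
  calc ∑ y, |(v ᵥ* P) y| = ∑ y, |∑ x, v x * (P x y - δ)| := by
        refine Finset.sum_congr rfl fun y _ => ?_
        simp only [vecMul, dotProduct, mul_sub, Finset.sum_sub_distrib, ← Finset.sum_mul, hv,
          zero_mul, sub_zero]
    _ ≤ ∑ y, ∑ x, |v x| * (P x y - δ) := by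
        refine Finset.sum_le_sum fun y _ => (Finset.abs_sum_le_sum_abs _ _).trans
          (Finset.sum_le_sum fun x _ => ?_)
        rw [abs_mul, abs_of_nonneg (sub_nonneg.2 (hδ x y))]
    _ = (1 - Fintype.card X * δ) * ∑ x, |v x| := by
        rw [Finset.sum_comm, Finset.mul_sum]
        refine Finset.sum_congr rfl fun x _ => ?_
        rw [← Finset.mul_sum, Finset.sum_sub_distrib, sum_row_of_mem_rowStochastic hP]
        simp [mul_comm]

variable [Nonempty X]

/-- Dobrushin's contraction estimate. -/
lemma exists_sum_abs_vecMul_le_of_pos (hP : P ∈ rowStochastic ℝ X) (hpos : ∀ x y, 0 < P x y) :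
    ∃ c ∈ Ioo (0 : ℝ) 1, ∀ v : X → ℝ, ∑ x, v x = 0 →
      ∑ y, |(v ᵥ* P) y| ≤ c * ∑ x, |v x| := by
  obtain ⟨⟨x₀, y₀⟩, hmin⟩ := Finite.exists_min fun z : X × X => P z.1 z.2
  have hmin₀ : 0 < P x₀ y₀ := hpos x₀ y₀
  have hcard : (0 : ℝ) < Fintype.card X := by exact_mod_cast Fintype.card_pos
  have hmass : Fintype.card X * P x₀ y₀ ≤ 1 := by
    rw [← sum_row_of_mem_rowStochastic hP x₀, ← nsmul_eq_mul, ← Finset.card_univ]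
    exact Finset.card_nsmul_le_sum _ _ _ fun y _ => hmin (x₀, y)
  have hcontr : 0 < Fintype.card X * P x₀ y₀ := mul_pos hcard hmin₀
  exact ⟨1 - Fintype.card X * (P x₀ y₀ / 2), ⟨by linarith, by linarith⟩, fun v hv =>
    sum_abs_vecMul_le hP (fun x y => (half_le_self hmin₀.le).trans (hmin (x, y))) hv⟩

lemma existsUnique_vecMul_eq_self_of_pos (hP : P ∈ rowStochastic ℝ X) (hpos : ∀ x y, 0 < P x y) :
    ∃! ν : X → ℝ, ν ∈ stdSimplex ℝ X ∧ ν ᵥ* P = ν := by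
  obtain ⟨c, hc, hcontr⟩ := exists_sum_abs_vecMul_le_of_pos hP hpos
  refine existsUnique_isFixedPt_of_forall_lt (d := fun ν μ => ∑ x, |(ν - μ) x|)
    (isCompact_stdSimplex ℝ X) ⟨_, single_mem_stdSimplex ℝ (Classical.arbitrary X)⟩
    (fun ν hν => vecMul_mem_stdSimplex hP hν) ?_ fun ν hν μ hμ hne => ?_
  · simp only [Pi.sub_apply, vecMul, dotProduct]
    fun_prop
  · have hmass : ∑ x, (ν - μ) x = 0 := by
      simp only [Pi.sub_apply, Finset.sum_sub_distrib, hν.2, hμ.2, sub_self]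
    obtain ⟨x, hx⟩ := Function.ne_iff.1 hne
    have hdist : 0 < ∑ x, |(ν - μ) x| :=
      Finset.sum_pos' (fun x _ => abs_nonneg _) ⟨x, Finset.mem_univ x, abs_pos.2 (sub_ne_zero.2 hx)⟩
    rw [← sub_vecMul]
    exact (hcontr _ hmass).trans_lt (mul_lt_of_lt_one_left hdist hc.2)

end Stochastic

lemma exp_smul_smul_one_apply {E : Type*} [NormedAddCommGroup E] [NormedSpace ℝ E]
    [CompleteSpace E] (s c : ℝ) (v : E) :
    NormedSpace.exp (s • (c • (1 : E →L[ℝ] E))) v = Real.exp (s * c) • v := by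
  have h := NormedSpace.algebraMap_exp_comm (𝕂 := ℝ) (𝔸 := E →L[ℝ] E) (s * c)
  rw [smul_smul, ← Algebra.algebraMap_eq_smul_one, ← h, Algebra.algebraMap_eq_smul_one,
    ← Real.exp_eq_exp_ℝ]
  rfl

namespace JumpRates

open MarkovChain LinearODE

variable {X : Type*} [Fintype X]

/-- Irreducibility for time-dependent rates: any state can be reached from any other one through
jumps whose rates are positive at all times. -/
def IsIrreducible (R : JumpRates X) : Prop :=
  ∀ x y, Relation.ReflTransGen (fun a b => ∀ u, 0 < R.rate u a b) x y

variable [MeasurableSpace X] [MeasurableSingletonClass X] (R : JumpRates X) {ν : X → ℝ} {t T : ℝ}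

lemma marginal_mul_rate_le_forwardGen_add {C : ℝ} (hC : ∀ u x, R.exitRate u x ≤ C) (s : ℝ)
    (x y : X) : R.marginal ν s x * R.rate s x y ≤
      forwardGen (R.rate s) (R.marginal ν s) y + C * R.marginal ν s y := by
  have hgen : forwardGen (R.rate s) (R.marginal ν s) y =
      ∑ z, R.marginal ν s z * R.rate s z y - R.exitRate s y * R.marginal ν s y := by
    rw [forwardGen_apply, Finset.sum_sub_distrib, ← Finset.mul_sum, exitRate, mul_comm]
  have hin : R.marginal ν s x * R.rate s x y ≤ ∑ z, R.marginal ν s z * R.rate s z y :=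
    Finset.single_le_sum (f := fun z => R.marginal ν s z * R.rate s z y)
      (fun z _ => mul_nonneg (R.marginal_nonneg ν s z) (R.rate_nonneg s z y)) (Finset.mem_univ x)
  have hout := mul_le_mul_of_nonneg_right (hC s y) (R.marginal_nonneg ν s y)
  linarith

/-- Variation of constants around the operator `-C`, which makes all the terms nonnegative. -/
lemma exp_mul_add_integral_le_marginal (hν : ν ∈ stdSimplex ℝ X) {C : ℝ}
    (hC : ∀ u x, R.exitRate u x ≤ C) (ht : 0 ≤ t) (x y : X) :
    Real.exp (t * -C) * ν y +
      ∫ s in (0 : ℝ)..t, Real.exp ((t - s) * -C) * (R.marginal ν s x * R.rate s x y)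
      ≤ R.marginal ν t y := by
  have hint := R.intervalIntegrable_forwardGen_marginal hν y 0 t
  have hmarg : IntervalIntegrable (fun s => R.marginal ν s y) volume 0 t :=
    intervalIntegrable_const.mono_fun' (g := fun _ => (1 : ℝ))
      (measurable_pi_iff.1 (R.measurable_marginal hν) y).aestronglyMeasurable
      (Filter.Eventually.of_forall fun s => by
        simpa only [Real.norm_of_nonneg (R.marginal_nonneg ν s y)] using R.marginal_le_one hν s y)
  have hduhamel := duhamel ((-C) • (1 : ℝ →L[ℝ] ℝ)) (P := fun s => R.marginal ν s y) ht hint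
    fun s hs => by
      rw [R.marginal_zero hν]
      exact R.marginal_eq_add_integral_forwardGen hν hs.1 y
  simp only [exp_smul_smul_one_apply, R.marginal_zero hν, smul_eq_mul,
    smul_apply, one_apply_eq_self, neg_mul, sub_neg_eq_add] at hduhamel
  rw [hduhamel]
  have hexp : ContinuousOn (fun s => Real.exp ((t - s) * -C)) (uIcc 0 t) := by fun_prop
  simp only [mul_neg] at hexp ⊢
  exact add_le_add_right (intervalIntegral.integral_mono_on ht
    ((R.intervalIntegrable_marginal_mul_rate hν x y 0 t).continuousOn_mul hexp)
    ((hint.add (hmarg.const_mul C)).continuousOn_mul hexp) fun s _ =>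
      mul_le_mul_of_nonneg_left (R.marginal_mul_rate_le_forwardGen_add hC s x y)
        (Real.exp_pos _).le) _

lemma marginal_pos (hR : R.IsIrreducible) (hν : ν ∈ stdSimplex ℝ X) (ht : 0 < t) (y : X) :
    0 < R.marginal ν t y := by
  obtain ⟨C, hC⟩ := R.exitRate_bounded
  have hlower {s : ℝ} (hs : 0 ≤ s) (x y : X) := R.exp_mul_add_integral_le_marginal hν
    (fun u x => (le_abs_self _).trans (hC u x)) hs x y
  have hnonneg (s u : ℝ) (x y : X) :
      0 ≤ Real.exp ((s - u) * -C) * (R.marginal ν u x * R.rate u x y) :=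
    mul_nonneg (Real.exp_pos _).le (mul_nonneg (R.marginal_nonneg ν u x) (R.rate_nonneg u x y))
  obtain ⟨x, hx⟩ : ∃ x, 0 < ν x := by
    by_contra! hcon
    linarith [hν.2, Finset.sum_nonpos fun x (_ : x ∈ Finset.univ) => hcon x]
  suffices h : ∀ s, 0 < s → 0 < R.marginal ν s y from h t ht
  induction hR x y with
  | refl =>
    refine fun s hs => lt_of_lt_of_le ?_ (hlower hs.le x x)
    exact add_pos_of_pos_of_nonneg (mul_pos (Real.exp_pos _) hx)
      (intervalIntegral.integral_nonneg hs.le fun u _ => hnonneg s u x x)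
  | @tail a b _ hab ih =>
    refine fun s hs => lt_of_lt_of_le ?_ (hlower hs.le a b)
    refine add_pos_of_nonneg_of_pos (mul_nonneg (Real.exp_pos _).le (hν.1 b)) ?_
    refine intervalIntegral.intervalIntegral_pos_of_pos_on ?_ (fun u hu => ?_) hs
    · exact (R.intervalIntegrable_marginal_mul_rate hν a b 0 s).continuousOn_mul (by fun_prop)
    · exact mul_pos (Real.exp_pos _) (mul_pos (ih u hu.1) (hab u))

section TransitionMatrix

variable [DecidableEq X]

/-- The transition probabilities `P(X_t = y | X_0 = x)`, as a row-stochastic matrix. -/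
noncomputable def transitionMatrix (t : ℝ) : Matrix X X ℝ :=
  Matrix.of fun x y => R.marginal (Pi.single x 1) t y

lemma transitionMatrix_mem_rowStochastic (ht : 0 ≤ t) :
    R.transitionMatrix t ∈ Matrix.rowStochastic ℝ X := by
  have hrow (x : X) := R.marginal_mem_stdSimplex (single_mem_stdSimplex ℝ x) ht
  exact Matrix.mem_rowStochastic_iff_sum.2 ⟨fun x => (hrow x).1, fun x => (hrow x).2⟩

lemma transitionMatrix_pos (hR : R.IsIrreducible) (ht : 0 < t) (x y : X) :
    0 < R.transitionMatrix t x y :=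
  R.marginal_pos hR (single_mem_stdSimplex ℝ x) ht y

lemma vecMul_transitionMatrix {p : ℝ → X → ℝ} (hp : p ∈ R.forwardSolutions) (ht : 0 ≤ t) :
    Matrix.vecMul (p 0) (R.transitionMatrix t) = p t := by
  funext y
  rw [R.eq_sum_smul_marginal hp ht]
  simp [Matrix.vecMul, dotProduct, transitionMatrix]

end TransitionMatrix

lemma existsUnique_isPeriodicInvariant [Nonempty X] (hR : R.IsIrreducible) (hT : 0 < T) :
    ∃! ν, R.IsPeriodicInvariant T ν := by
  classical
  refine (existsUnique_congr fun ν => and_congr_right fun hν => ?_).1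
    (existsUnique_vecMul_eq_self_of_pos (R.transitionMatrix_mem_rowStochastic hT.le)
      (R.transitionMatrix_pos hR hT))
  rw [← R.vecMul_transitionMatrix (R.marginal_mem_forwardSolutions hν) hT.le, R.marginal_zero hν]

end JumpRates

/-! ### Exponentially stable semigroups -/

namespace LinearODE

open Asymptotics Filter Topology

variable {E : Type*} [NormedAddCommGroup E] [NormedSpace ℝ E] {A : E →L[ℝ] E} {V : Submodule ℝ E}

/-- Exponential decay of the semigroup generated by `A` on a subspace `V`. -/
def IsExpStableOn (A : E →L[ℝ] E) (V : Submodule ℝ E) : Prop :=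
  ∃ K b : ℝ, 0 < b ∧ ∀ s, 0 ≤ s → ∀ v ∈ V,
    ‖NormedSpace.exp (s • A) v‖ ≤ K * Real.exp (-b * s) * ‖v‖

/-- The forcing terms of the equation `u' = A u + f` considered here: strongly measurable bounded
functions of time with values in `V`. -/
def boundedForcings (V : Submodule ℝ E) : Submodule ℝ (ℝ → E) where
  carrier := {f | StronglyMeasurable f ∧ (∃ M, ∀ u, ‖f u‖ ≤ M) ∧ ∀ u, f u ∈ V}
  zero_mem' := ⟨stronglyMeasurable_zero, ⟨0, by simp⟩, fun _ => V.zero_mem⟩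
  add_mem' := fun ⟨hf, ⟨M, hM⟩, hfV⟩ ⟨hg, ⟨N, hN⟩, hgV⟩ =>
    ⟨hf.add hg, ⟨M + N, fun u => norm_add_le_of_le (hM u) (hN u)⟩,
      fun u => V.add_mem (hfV u) (hgV u)⟩
  smul_mem' c _ := fun ⟨hf, ⟨M, hM⟩, hfV⟩ =>
    ⟨hf.const_smul c, ⟨‖c‖ * M, fun u =>
      (norm_smul_le c _).trans (mul_le_mul_of_nonneg_left (hM u) (norm_nonneg c))⟩,
      fun u => V.smul_mem c (hfV u)⟩

lemma mem_boundedForcings {f : ℝ → E} : f ∈ boundedForcings V ↔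
    StronglyMeasurable f ∧ (∃ M, ∀ u, ‖f u‖ ≤ M) ∧ ∀ u, f u ∈ V := Iff.rfl

/-- The solution `∫ s in (0, ∞), exp (s A) f (t - s)` of `u' = A u + f` which has forgotten its
initial value. -/
noncomputable def expConvolution (A : E →L[ℝ] E) (f : ℝ → E) (t : ℝ) : E :=
  ∫ s in Ioi (0 : ℝ), NormedSpace.exp (s • A) (f (t - s))

lemma IsExpStableOn.tendsto_exp_smul_apply (hA : IsExpStableOn A V) {v : E} (hv : v ∈ V) :
    Tendsto (fun s : ℝ => NormedSpace.exp (s • A) v) atTop (𝓝 0) := by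
  obtain ⟨K, b, hb, h⟩ := hA
  have hexp : Tendsto (fun s : ℝ => Real.exp (-b * s)) atTop (𝓝 0) :=
    Real.tendsto_exp_atBot.comp (tendsto_id.const_mul_atTop_of_neg (neg_neg_iff_pos.2 hb))
  refine squeeze_zero_norm' ?_ (by simpa using (hexp.const_mul K).mul_const ‖v‖)
  filter_upwards [eventually_ge_atTop 0] with s hs using by simpa using h s hs v hv

variable {f g : ℝ → E}

lemma IsExpStableOn.exists_norm_le (hA : IsExpStableOn A V) :
    ∃ k : ℝ → ℝ, IntegrableOn k (Ioi 0) ∧ ∀ f ∈ boundedForcings V, ∀ M, (∀ u, ‖f u‖ ≤ M) →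
      ∀ t, ∀ s ∈ Ioi 0, ‖NormedSpace.exp (s • A) (f (t - s))‖ ≤ k s * M := by
  obtain ⟨K, b, hb, h⟩ := hA
  refine ⟨fun s => |K| * Real.exp (-b * s),
    (integrableOn_exp_mul_Ioi (neg_neg_iff_pos.2 hb) 0).const_mul _, fun f hf M hM t s hs => ?_⟩
  calc ‖NormedSpace.exp (s • A) (f (t - s))‖ ≤ K * Real.exp (-b * s) * ‖f (t - s)‖ :=
        h s (mem_Ioi.1 hs).le _ ((mem_boundedForcings.1 hf).2.2 _)
    _ ≤ |K| * Real.exp (-b * s) * M := by gcongr; exacts [le_abs_self K, hM _]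

lemma IsExpStableOn.exists_norm_expConvolution_le (hA : IsExpStableOn A V) :
    ∃ K : ℝ, 0 < K ∧ ∀ f ∈ boundedForcings V, ∀ M, (∀ u, ‖f u‖ ≤ M) →
      ∀ t, ‖expConvolution A f t‖ ≤ K * M := by
  obtain ⟨k, hk, h⟩ := hA.exists_norm_le
  refine ⟨|∫ s in Ioi 0, k s| + 1, by positivity, fun f hf M hM t => ?_⟩
  have hM₀ : 0 ≤ M := (norm_nonneg _).trans (hM 0)
  calc ‖expConvolution A f t‖ ≤ ∫ s in Ioi 0, k s * M :=
        norm_integral_le_of_norm_le (hk.mul_const M)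
          (ae_restrict_of_forall_mem measurableSet_Ioi (h f hf M hM t))
    _ = (∫ s in Ioi 0, k s) * M := integral_mul_const _ _
    _ ≤ (|∫ s in Ioi 0, k s| + 1) * M := by
        gcongr
        linarith [le_abs_self (∫ s in Ioi 0, k s)]

lemma IsExpStableOn.exists_isBigOWith_expConvolution (hA : IsExpStableOn A V) :
    ∃ K : ℝ, 0 < K ∧ ∀ {F : ℝ → ℝ → E} {φ : ℝ → ℝ} {l₀ : Filter ℝ} {c : ℝ},
      (∀ l, F l ∈ boundedForcings V) →
      IsBigOWith c (l₀ ×ˢ ⊤) (fun q : ℝ × ℝ => F q.1 q.2) (fun q => φ q.1) →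
      IsBigOWith (K * c) (l₀ ×ˢ ⊤) (fun q : ℝ × ℝ => expConvolution A (F q.1) q.2)
        (fun q => φ q.1) := by
  obtain ⟨K, hK, h⟩ := hA.exists_norm_expConvolution_le
  refine ⟨K, hK, fun {F φ l₀ c} hF hc => ?_⟩
  have hbound : ∀ᶠ l in l₀, ∀ t, ‖F l t‖ ≤ c * ‖φ l‖ := mem_prod_top.1 hc.bound
  refine isBigOWith_iff.2 (mem_prod_top.2 (hbound.mono fun l hl t => ?_))
  rw [mem_ofPred_eq, mul_assoc]
  exact h (F l) (hF l) _ hl t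

lemma isBigO_expConvolution (hA : IsExpStableOn A V) {F : ℝ → ℝ → E} {φ : ℝ → ℝ} {l₀ : Filter ℝ}
    (hF : ∀ l, F l ∈ boundedForcings V)
    (hO : (fun q : ℝ × ℝ => F q.1 q.2) =O[l₀ ×ˢ ⊤] fun q => φ q.1) :
    (fun q : ℝ × ℝ => expConvolution A (F q.1) q.2) =O[l₀ ×ˢ ⊤] fun q => φ q.1 := by
  obtain ⟨K, -, h⟩ := hA.exists_isBigOWith_expConvolution
  obtain ⟨c, hc⟩ := hO.isBigOWith
  exact (h hF hc).isBigO

lemma isLittleO_expConvolution (hA : IsExpStableOn A V) {F : ℝ → ℝ → E} {φ : ℝ → ℝ}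
    {l₀ : Filter ℝ} (hF : ∀ l, F l ∈ boundedForcings V)
    (ho : (fun q : ℝ × ℝ => F q.1 q.2) =o[l₀ ×ˢ ⊤] fun q => φ q.1) :
    (fun q : ℝ × ℝ => expConvolution A (F q.1) q.2) =o[l₀ ×ˢ ⊤] fun q => φ q.1 := by
  obtain ⟨K, hK, h⟩ := hA.exists_isBigOWith_expConvolution
  refine IsLittleO.of_isBigOWith fun c hc => ?_
  simpa [mul_div_cancel₀ c hK.ne'] using h hF (ho.forall_isBigOWith (div_pos hc hK))

lemma expConvolution_smul (c : ℝ) (t : ℝ) :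
    expConvolution A (c • f) t = c • expConvolution A f t := by
  simp only [expConvolution, Pi.smul_apply, map_smul]
  exact integral_smul c _

variable [CompleteSpace E]

lemma integrableOn_exp_smul_apply (hA : IsExpStableOn A V) (hf : f ∈ boundedForcings V) (t : ℝ) :
    IntegrableOn (fun s : ℝ => NormedSpace.exp (s • A) (f (t - s))) (Ioi 0) := by
  obtain ⟨k, hk, h⟩ := hA.exists_norm_le
  obtain ⟨hfm, ⟨M, hM⟩, -⟩ := mem_boundedForcings.1 hf
  refine Integrable.mono' (hk.mul_const M) ?_
    (ae_restrict_of_forall_mem measurableSet_Ioi (h f hf M hM t))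
  exact (ContinuousLinearMap.apply ℝ E).flip.aestronglyMeasurable_comp₂
    (continuous_exp_smul A).aestronglyMeasurable
    (hfm.comp_measurable (measurable_const.sub measurable_id)).aestronglyMeasurable

lemma expConvolution_sub (hA : IsExpStableOn A V) (hf : f ∈ boundedForcings V)
    (hg : g ∈ boundedForcings V) (t : ℝ) :
    expConvolution A (f - g) t = expConvolution A f t - expConvolution A g t := by
  simp only [expConvolution, Pi.sub_apply, map_sub]
  exact integral_sub (integrableOn_exp_smul_apply hA hf t) (integrableOn_exp_smul_apply hA hg t)

variable {L : ℝ → E →L[ℝ] E} {p : ℝ → E} {w : E} {T : ℝ}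

lemma sub_eq_exp_smul_add_integral (hw : A w = 0) (hp : p ∈ solutions L) {t : ℝ} (ht : 0 ≤ t) :
    p t - w = NormedSpace.exp (t • A) (p 0 - w) +
      ∫ s in (0 : ℝ)..t, NormedSpace.exp (s • A) ((L (t - s) - A) (p (t - s))) := by
  have h := duhamel A (P := fun s => p s - w) ht (intervalIntegrable_of_mem_solutions hp ht)
    fun s hs => by rw [eq_add_integral_of_mem_solutions hp hs.1]; abel
  have hreverse := intervalIntegral.integral_comp_sub_left
    (fun s => NormedSpace.exp ((t - s) • A) ((L s - A) (p s))) t (a := 0) (b := t)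
  simp only [sub_sub_cancel, sub_zero, sub_self] at hreverse
  rw [h, hreverse]
  simp only [map_sub, hw, sub_zero, sub_apply]

/-- A periodic solution started a large number of periods ago has forgotten its initial value. -/
theorem sub_eq_expConvolution_of_periodic (hA : IsExpStableOn A V) (hw : A w = 0)
    (hp : p ∈ solutions L) (hT : 0 < T) (hpT : Function.Periodic p T)
    (hLT : Function.Periodic L T) (hp₀ : p 0 - w ∈ V)
    (hf : (fun u => (L u - A) (p u)) ∈ boundedForcings V) (t : ℝ) :
    p t - w = expConvolution A (fun u => (L u - A) (p u)) t := by
  have htend : Tendsto (fun n : ℕ => t + n * T) atTop atTop :=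
    tendsto_atTop_add_const_left _ _ (tendsto_natCast_atTop_atTop.atTop_mul_const hT)
  have hlim := ((hA.tendsto_exp_smul_apply hp₀).comp htend).add
    (intervalIntegral_tendsto_integral_Ioi 0 (integrableOn_exp_smul_apply hA hf t) htend)
  rw [zero_add] at hlim
  refine tendsto_nhds_unique (tendsto_const_nhds.congr' ?_) hlim
  filter_upwards [htend.eventually_ge_atTop 0] with n hn
  have hshift (s : ℝ) : t + n * T - s = t - s + n * T := by ring
  rw [← hpT.nat_mul n t, sub_eq_exp_smul_add_integral hw hp hn]
  simp only [hshift, hpT.nat_mul n _, hLT.nat_mul n _, Function.comp_apply]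

end LinearODE

open Asymptotics in
lemma isBigO_clm_apply {α E F : Type*} [SeminormedAddCommGroup E] [NormedSpace ℝ E]
    [SeminormedAddCommGroup F] [NormedSpace ℝ F] (L : α → E →L[ℝ] F) (v : α → E) (l : Filter α) :
    (fun a => L a (v a)) =O[l] fun a => ‖L a‖ * ‖v a‖ :=
  .of_bound 1 (.of_forall fun a => by simpa using (L a).le_opNorm (v a))

namespace LinearODE

open Asymptotics Filter Topology

variable {E : Type*} [NormedAddCommGroup E] [NormedSpace ℝ E] {A : E →L[ℝ] E}
  {V : Submodule ℝ E} {L : ℝ → ℝ → E →L[ℝ] E} {B : ℝ → E →L[ℝ] E} {p : ℝ → ℝ → E} {w : E}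

lemma isBigO_sub_of_sub_eq_expConvolution (hA : IsExpStableOn A V)
    (hp : ∀ l t, p l t - w = expConvolution A (fun u => (L l u - A) (p l u)) t)
    (hf : ∀ l, (fun u => (L l u - A) (p l u)) ∈ boundedForcings V)
    (hp_bdd : (fun q : ℝ × ℝ => p q.1 q.2) =O[𝓝 0 ×ˢ ⊤] fun _ => (1 : ℝ))
    (hL : (fun q : ℝ × ℝ => L q.1 q.2 - A) =O[𝓝 0 ×ˢ ⊤] fun q => q.1) :
    (fun q : ℝ × ℝ => p q.1 q.2 - w) =O[𝓝 0 ×ˢ ⊤] fun q => q.1 := by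
  simp only [hp]
  refine isBigO_expConvolution (φ := fun l => l) hA hf ((isBigO_clm_apply _ _ _).trans ?_)
  simpa using hL.norm_left.mul hp_bdd.norm_left

/-- The `⊤` in the product filters makes the expansions uniform in time. -/
theorem hasDerivAt_of_sub_eq_expConvolution [CompleteSpace E] (hA : IsExpStableOn A V)
    (hp : ∀ l t, p l t - w = expConvolution A (fun u => (L l u - A) (p l u)) t)
    (hf : ∀ l, (fun u => (L l u - A) (p l u)) ∈ boundedForcings V)
    (hp_bdd : (fun q : ℝ × ℝ => p q.1 q.2) =O[𝓝 0 ×ˢ ⊤] fun _ => (1 : ℝ))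
    (hB_bdd : B =O[⊤] fun _ => (1 : ℝ)) (hBw : (fun u => B u w) ∈ boundedForcings V)
    (hL : (fun q : ℝ × ℝ => L q.1 q.2 - A - q.1 • B q.2) =o[𝓝 0 ×ˢ ⊤] fun q => q.1) (t : ℝ) :
    HasDerivAt (fun l => p l t) (expConvolution A (fun u => B u w) t) 0 := by
  have hlB : (fun q : ℝ × ℝ => q.1 • B q.2) =O[𝓝 0 ×ˢ ⊤] fun q => q.1 := by
    simpa using (isBigO_refl (fun q : ℝ × ℝ => q.1) _).smul (hB_bdd.comp_tendsto tendsto_snd)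
  have hdev : (fun q : ℝ × ℝ => p q.1 q.2 - w) =O[𝓝 0 ×ˢ ⊤] fun q => q.1 :=
    isBigO_sub_of_sub_eq_expConvolution hA hp hf hp_bdd (by simpa using hL.isBigO.add hlB)
  have hp₀ : p 0 t = w := by
    obtain ⟨C, hC⟩ := hdev.bound
    have h : ∀ᶠ l in 𝓝 (0 : ℝ), ∀ t, ‖p l t - w‖ ≤ C * ‖l‖ := mem_prod_top.1 hC
    simpa [sub_eq_zero] using h.self_of_nhds t
  let F : ℝ → ℝ → E := fun l => (fun u => (L l u - A) (p l u)) - l • fun u => B u w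
  have hF : (fun q : ℝ × ℝ => F q.1 q.2) =o[𝓝 0 ×ˢ ⊤] fun q => q.1 := by
    have hsplit (q : ℝ × ℝ) : F q.1 q.2 =
        (L q.1 q.2 - A - q.1 • B q.2) (p q.1 q.2) + (q.1 • B q.2) (p q.1 q.2 - w) := by
      simp only [F, Pi.sub_apply, Pi.smul_apply, sub_apply, smul_apply, map_sub]
      abel
    simp only [hsplit]
    refine .add ((isBigO_clm_apply _ _ _).trans_isLittleO ?_)
      ((isBigO_clm_apply _ _ _).trans_isLittleO ?_)
    · simpa using hL.norm_left.mul_isBigO hp_bdd.norm_left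
    · refine (hlB.norm_left.mul hdev.norm_left).trans_isLittleO ?_
      have h₀ : (fun q : ℝ × ℝ => q.1) =o[𝓝 0 ×ˢ ⊤] fun _ => (1 : ℝ) :=
        (isLittleO_one_iff ℝ).2 tendsto_fst
      simpa using h₀.mul_isBigO (isBigO_refl (fun q : ℝ × ℝ => q.1) _)
  have hconv := isLittleO_expConvolution (φ := fun l => l) hA
    (fun l => sub_mem (hf l) (Submodule.smul_mem _ l hBw)) hF
  rw [hasDerivAt_iff_isLittleO_nhds_zero]
  refine (hconv.comp_tendsto (k := fun l => (l, t)) (tendsto_id.prodMk tendsto_top)).congr_left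
    fun l => ?_
  simp only [Function.comp_apply, zero_add, hp₀]
  rw [expConvolution_sub hA (hf l) (Submodule.smul_mem _ l hBw), ← hp, expConvolution_smul]

end LinearODE

lemma pow_natFloor_le_inv_mul_exp {c : ℝ} (hc : c ∈ Ioc 0 1) (s : ℝ) :
    c ^ ⌊s⌋₊ ≤ c⁻¹ * Real.exp (Real.log c * s) := by
  rw [← Real.rpow_def_of_pos hc.1, ← Real.rpow_neg_one, ← Real.rpow_add hc.1, ← Real.rpow_natCast]
  exact Real.rpow_le_rpow_of_exponent_ge hc.1 hc.2 (by linarith [Nat.lt_floor_add_one s])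

lemma LinearODE.exp_smul_mem_solutions {E : Type*} [NormedAddCommGroup E] [NormedSpace ℝ E]
    [CompleteSpace E] (A : E →L[ℝ] E) (v : E) :
    (fun t : ℝ => NormedSpace.exp (t • A) v) ∈ solutions fun _ => A := by
  intro t _
  have hderiv (s : ℝ) : HasDerivAt (fun s : ℝ => NormedSpace.exp (s • A) v)
      (A (NormedSpace.exp (s • A) v)) s :=
    ((hasDerivAt_exp_smul_const' A s).clm_apply (hasDerivAt_const s v)).congr_deriv (by simp)
  have hint : IntervalIntegrable (fun u : ℝ => A (NormedSpace.exp (u • A) v)) volume 0 t :=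
    (A.continuous.comp ((continuous_exp_smul A).clm_apply continuous_const)).intervalIntegrable _ _
  refine ⟨hint, ?_⟩
  rw [intervalIntegral.integral_eq_sub_of_hasDerivAt (fun s _ => hderiv s) hint]
  abel

namespace MarkovChain

open LinearODE Matrix

section IsIrreducible

variable {X : Type*} [Fintype X] {r : X → X → ℝ} {hr : ∀ x y, 0 ≤ r x y}
  {hpos : ∀ x, 0 < ∑ y, r x y}

lemma isIrreducible_unperturbed (hirr : IsIrreducible r) :
    (unperturbed r hr hpos).IsIrreducible := fun x y =>
  Relation.ReflTransGen.mono (fun _ _ h _ => h) _ _ (hirr x y)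

lemma isIrreducible_perturbed (hirr : IsIrreducible r) {g : ℝ → X → X → ℝ}
    {hgm : ∀ x y, Measurable fun t => g t x y} {hgb : ∃ G : ℝ, ∀ t x y, |g t x y| ≤ G} (lam : ℝ) :
    (perturbed r hr hpos g hgm hgb lam).IsIrreducible := fun x y =>
  Relation.ReflTransGen.mono (fun _ _ h _ => mul_pos (Real.exp_pos _) h) _ _ (hirr x y)

end IsIrreducible

variable {X : Type*} [Fintype X]

/-- The vectors of total mass zero, among them the differences of probability vectors. -/
def massZero (X : Type*) [Fintype X] : Submodule ℝ (X → ℝ) :=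
  LinearMap.ker (∑ x : X, LinearMap.proj x)

lemma mem_massZero {v : X → ℝ} : v ∈ massZero X ↔ ∑ x, v x = 0 := by simp [massZero]

lemma sub_mem_massZero {μ ν : X → ℝ} (hμ : μ ∈ stdSimplex ℝ X) (hν : ν ∈ stdSimplex ℝ X) :
    μ - ν ∈ massZero X := by
  simp [mem_massZero, hμ.2, hν.2]

lemma forwardGen_mem_massZero (ρ : X → X → ℝ) (v : X → ℝ) : forwardGen ρ v ∈ massZero X :=
  mem_massZero.2 (sum_forwardGen ρ v)

variable {r : X → X → ℝ} {t : ℝ} {v : X → ℝ}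

lemma exp_smul_forwardGen_mem_massZero (hv : v ∈ massZero X) (ht : 0 ≤ t) :
    NormedSpace.exp (t • forwardGen r) v ∈ massZero X := by
  have h := sum_eq_of_mem_solutions (exp_smul_mem_solutions (forwardGen r) v) ht
  simpa [mem_massZero, h] using hv

variable [MeasurableSpace X] [MeasurableSingletonClass X] {hr : ∀ x y, 0 ≤ r x y}
  {hpos : ∀ x, 0 < ∑ y, r x y}

lemma vecMul_transitionMatrix_unperturbed [DecidableEq X] (v : X → ℝ) (ht : 0 ≤ t) :
    v ᵥ* (unperturbed r hr hpos).transitionMatrix t = NormedSpace.exp (t • forwardGen r) v := by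
  simpa using (unperturbed r hr hpos).vecMul_transitionMatrix
    (exp_smul_mem_solutions (forwardGen r) v) ht

lemma sum_abs_exp_smul_forwardGen_le (hr : ∀ x y, 0 ≤ r x y) (hpos : ∀ x, 0 < ∑ y, r x y)
    (hv : v ∈ massZero X) (ht : 0 ≤ t) :
    ∑ y, |NormedSpace.exp (t • forwardGen r) v y| ≤ ∑ x, |v x| := by
  classical
  have hP := (unperturbed r hr hpos).transitionMatrix_mem_rowStochastic ht
  rw [← vecMul_transitionMatrix_unperturbed (hr := hr) (hpos := hpos) v ht]
  simpa using sum_abs_vecMul_le hP (δ := 0) (fun x y => nonneg_of_mem_rowStochastic hP)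
    (mem_massZero.1 hv)

variable [Nonempty X]

lemma exists_sum_abs_exp_natCast_smul_forwardGen_le (hr : ∀ x y, 0 ≤ r x y)
    (hpos : ∀ x, 0 < ∑ y, r x y) (hirr : IsIrreducible r) :
    ∃ c ∈ Ioo (0 : ℝ) 1, ∀ n : ℕ, ∀ v ∈ massZero X,
      ∑ y, |NormedSpace.exp ((n : ℝ) • forwardGen r) v y| ≤ c ^ n * ∑ x, |v x| := by
  classical
  obtain ⟨c, hc, hcontr⟩ := exists_sum_abs_vecMul_le_of_pos
    ((unperturbed r hr hpos).transitionMatrix_mem_rowStochastic zero_le_one)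
    ((unperturbed r hr hpos).transitionMatrix_pos (isIrreducible_unperturbed hirr) one_pos)
  simp only [vecMul_transitionMatrix_unperturbed _ zero_le_one, ← mem_massZero] at hcontr
  refine ⟨c, hc, fun n => ?_⟩
  induction n with
  | zero => simp
  | succ n ih =>
    intro v hv
    rw [Nat.cast_succ, add_comm, exp_add_smul_apply, pow_succ', mul_assoc]
    exact (hcontr _ (exp_smul_forwardGen_mem_massZero hv n.cast_nonneg)).trans
      (mul_le_mul_of_nonneg_left (ih v hv) hc.1.le)

theorem isExpStableOn_forwardGen (hr : ∀ x y, 0 ≤ r x y) (hpos : ∀ x, 0 < ∑ y, r x y)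
    (hirr : IsIrreducible r) : IsExpStableOn (forwardGen r) (massZero X) := by
  obtain ⟨c, hc, hcontr⟩ := exists_sum_abs_exp_natCast_smul_forwardGen_le hr hpos hirr
  refine ⟨c⁻¹ * Fintype.card X, -Real.log c, neg_pos.2 (Real.log_neg hc.1 hc.2),
    fun s hs v hv => ?_⟩
  have hfloor : 0 ≤ s - ⌊s⌋₊ := sub_nonneg.2 (Nat.floor_le hs)
  have hsplit : NormedSpace.exp (s • forwardGen r) v = NormedSpace.exp ((s - ⌊s⌋₊) • forwardGen r)
      (NormedSpace.exp ((⌊s⌋₊ : ℝ) • forwardGen r) v) := by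
    rw [← exp_add_smul_apply, sub_add_cancel]
  calc ‖NormedSpace.exp (s • forwardGen r) v‖ ≤ ∑ y, |NormedSpace.exp (s • forwardGen r) v y| :=
        (pi_norm_le_iff_of_nonneg (Finset.sum_nonneg fun _ _ => abs_nonneg _)).2 fun y =>
          Finset.single_le_sum (f := fun y => |NormedSpace.exp (s • forwardGen r) v y|)
            (fun _ _ => abs_nonneg _) (Finset.mem_univ y)
    _ ≤ ∑ y, |NormedSpace.exp ((⌊s⌋₊ : ℝ) • forwardGen r) v y| := by
        rw [hsplit]
        exact sum_abs_exp_smul_forwardGen_le hr hpos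
          (exp_smul_forwardGen_mem_massZero hv (Nat.cast_nonneg _)) hfloor
    _ ≤ c ^ ⌊s⌋₊ * ∑ x, |v x| := hcontr _ v hv
    _ ≤ c⁻¹ * Real.exp (Real.log c * s) * (Fintype.card X * ‖v‖) := by
        gcongr
        · exact mul_nonneg (inv_nonneg.2 hc.1.le) (Real.exp_pos _).le
        · exact pow_natFloor_le_inv_mul_exp ⟨hc.1, hc.2.le⟩ s
        · simpa using Pi.sum_norm_apply_le_norm v
    _ = c⁻¹ * Fintype.card X * Real.exp (-(-Real.log c) * s) * ‖v‖ := by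
        rw [neg_neg]
        ring

end MarkovChain

lemma norm_le_one_of_mem_stdSimplex {X : Type*} [Fintype X] {p : X → ℝ}
    (hp : p ∈ stdSimplex ℝ X) : ‖p‖ ≤ 1 :=
  (pi_norm_le_iff_of_nonneg zero_le_one).2 fun x => by
    simpa only [Real.norm_of_nonneg (hp.1 x), ← hp.2] using
      Finset.single_le_sum (fun y _ => hp.1 y) (Finset.mem_univ x)

lemma LinearODE.mem_solutions_of_eqOn {E : Type*} [NormedAddCommGroup E] [NormedSpace ℝ E]
    {L : ℝ → E →L[ℝ] E} {p q : ℝ → E} (hpq : EqOn p q (Ici 0)) (hq : q ∈ solutions L) :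
    p ∈ solutions L := by
  intro t ht
  have hL : EqOn (fun u => L u (q u)) (fun u => L u (p u)) (uIcc 0 t) := fun u hu => by
    rw [uIcc_of_le ht] at hu
    simp only [hpq hu.1]
  refine ⟨(intervalIntegrable_of_mem_solutions hq ht).congr (hL.mono uIoc_subset_uIcc), ?_⟩
  rw [hpq ht, hpq self_mem_Ici, ← intervalIntegral.integral_congr hL]
  exact eq_add_integral_of_mem_solutions hq ht

namespace JumpRates

open MarkovChain LinearODE

variable {X : Type*} [Fintype X] [MeasurableSpace X] [MeasurableSingletonClass X]
  (R : JumpRates X) {ν : X → ℝ} {t T : ℝ}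

lemma marginal_add_period (hν : ν ∈ stdSimplex ℝ X) (hR : Function.Periodic R.rate T)
    (hT : 0 ≤ T) (ht : 0 ≤ t) : R.marginal ν (t + T) = R.marginal (R.marginal ν T) t := by
  have hνT := R.marginal_mem_stdSimplex hν hT
  refine R.eq_of_mem_forwardSolutions
    (comp_add_mem_solutions (R.marginal_mem_forwardSolutions hν) hT (hR.comp _))
    (R.marginal_mem_forwardSolutions hνT) ?_ ht
  rw [zero_add, R.marginal_zero hνT]

/-- The marginals on `[0, T)` of the process with initial distribution `ν`, repeated periodically
over all of `ℝ`. For the oscillatory steady state this extends the marginals to negative times. -/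
noncomputable def periodicMarginal (ν : X → ℝ) (hT : 0 < T) (t : ℝ) : X → ℝ :=
  R.marginal ν (toIcoMod hT 0 t)

lemma periodic_periodicMarginal (ν : X → ℝ) (hT : 0 < T) :
    Function.Periodic (R.periodicMarginal ν hT) T :=
  (toIcoMod_periodic hT 0).comp (R.marginal ν)

lemma periodicMarginal_mem_stdSimplex (hν : ν ∈ stdSimplex ℝ X) (hT : 0 < T) (t : ℝ) :
    R.periodicMarginal ν hT t ∈ stdSimplex ℝ X :=
  R.marginal_mem_stdSimplex hν (left_le_toIcoMod hT 0 t)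

lemma measurable_periodicMarginal (hν : ν ∈ stdSimplex ℝ X) (hT : 0 < T) :
    Measurable (R.periodicMarginal ν hT) := by
  refine (R.measurable_marginal hν).comp ?_
  simp only [funext (toIcoMod_eq_add_fract_mul hT 0)]
  fun_prop

namespace IsPeriodicInvariant

variable {R}

lemma marginal_add_nsmul (hν : R.IsPeriodicInvariant T ν) (hR : Function.Periodic R.rate T)
    (hT : 0 ≤ T) (ht : 0 ≤ t) (n : ℕ) : R.marginal ν (t + n • T) = R.marginal ν t := by
  induction n with
  | zero => simp
  | succ n ih =>
    rw [succ_nsmul, ← add_assoc, R.marginal_add_period hν.1 hR hT (by positivity), hν.2, ih]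

lemma periodicMarginal_eq (hν : R.IsPeriodicInvariant T ν) (hR : Function.Periodic R.rate T)
    (hT : 0 < T) (ht : 0 ≤ t) : R.periodicMarginal ν hT t = R.marginal ν t := by
  have hdiv : 0 ≤ toIcoDiv hT 0 t := by
    rw [toIcoDiv_eq_floor, sub_zero]
    positivity
  obtain ⟨n, hn⟩ := Int.eq_ofNat_of_zero_le hdiv
  have hmod : toIcoMod hT 0 t + n • T = t := by
    simpa only [hn, natCast_zsmul] using toIcoMod_add_toIcoDiv_zsmul hT 0 t
  rw [periodicMarginal, ← hν.marginal_add_nsmul hR hT.le (left_le_toIcoMod hT 0 t) n, hmod]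

lemma periodicMarginal_mem_forwardSolutions (hν : R.IsPeriodicInvariant T ν)
    (hR : Function.Periodic R.rate T) (hT : 0 < T) :
    R.periodicMarginal ν hT ∈ R.forwardSolutions :=
  mem_solutions_of_eqOn (fun _ ht => hν.periodicMarginal_eq hR hT ht)
    (R.marginal_mem_forwardSolutions hν.1)

end IsPeriodicInvariant

end JumpRates

namespace MarkovChain

open LinearODE

variable {X : Type*} [Fintype X]

lemma forwardGen_mem_boundedForcings {ρ : ℝ → X → X → ℝ} (hρ : Measurable ρ)
    (hρC : ∃ C, ∀ t, ‖ρ t‖ ≤ C) {p : ℝ → X → ℝ} (hp : Measurable p)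
    (hpX : ∀ t, p t ∈ stdSimplex ℝ X) :
    (fun t => forwardGen (ρ t) (p t)) ∈ boundedForcings (massZero X) := by
  obtain ⟨C, hC⟩ := hρC
  refine mem_boundedForcings.2 ⟨(measurable_forwardGen hρ hp).stronglyMeasurable,
    ⟨‖forwardGen (X := X)‖ * C * 1, fun t => ?_⟩, fun t => forwardGen_mem_massZero _ _⟩
  exact ContinuousLinearMap.le_of_opNorm_le_of_le _ (forwardGen.le_opNorm_of_le (hC t))
    (norm_le_one_of_mem_stdSimplex (hpX t))

variable [MeasurableSpace X] [MeasurableSingletonClass X] {r : X → X → ℝ} {π : X → ℝ}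

section Periodic

variable {R : JumpRates X} {ν : X → ℝ} {T : ℝ}

lemma forwardGen_sub_mem_boundedForcings (r : X → X → ℝ) (hν : ν ∈ stdSimplex ℝ X) (hT : 0 < T) :
    (fun t => (forwardGen (R.rate t) - forwardGen r) (R.periodicMarginal ν hT t)) ∈
      boundedForcings (massZero X) := by
  simp only [← map_sub]
  obtain ⟨C, hC⟩ := R.exists_norm_rate_le
  exact forwardGen_mem_boundedForcings (R.measurable_rate_pi.sub_const r)
    ⟨C + ‖r‖, fun t => norm_sub_le_of_le (hC t) le_rfl⟩ (R.measurable_periodicMarginal hν hT)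
    (R.periodicMarginal_mem_stdSimplex hν hT)

theorem periodicMarginal_sub_eq_expConvolution
    (hstable : IsExpStableOn (forwardGen r) (massZero X)) (hπ : π ∈ stdSimplex ℝ X)
    (hπ₀ : forwardGen r π = 0) (hν : R.IsPeriodicInvariant T ν) (hR : Function.Periodic R.rate T)
    (hT : 0 < T) (t : ℝ) : R.periodicMarginal ν hT t - π = expConvolution (forwardGen r)
      (fun u => (forwardGen (R.rate u) - forwardGen r) (R.periodicMarginal ν hT u)) t :=
  sub_eq_expConvolution_of_periodic hstable hπ₀
    (hν.periodicMarginal_mem_forwardSolutions hR hT) hT (R.periodic_periodicMarginal ν hT)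
    (hR.comp _) (sub_mem_massZero (R.periodicMarginal_mem_stdSimplex hν.1 hT 0) hπ)
    (forwardGen_sub_mem_boundedForcings r hν.1 hT) t

end Periodic

variable {hr : ∀ x y, 0 ≤ r x y} {hpos : ∀ x, 0 < ∑ y, r x y}

lemma existsUnique_isInvariant [Nonempty X] (hirr : IsIrreducible r) :
    ∃! π : X → ℝ, (unperturbed r hr hpos).IsInvariant π := by
  have hper (T : ℝ) : Function.Periodic (unperturbed r hr hpos).rate T := fun t => rfl
  obtain ⟨π, ⟨hπ, hπ₁⟩, huniq⟩ := (unperturbed r hr hpos).existsUnique_isPeriodicInvariant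
    (isIrreducible_unperturbed hirr) one_pos
  refine ⟨π, ⟨hπ, fun t ht => huniq _ ⟨JumpRates.marginal_mem_stdSimplex _ hπ ht, ?_⟩⟩,
    fun μ hμ => huniq μ ⟨hμ.1, hμ.2 1 zero_le_one⟩⟩
  rw [← JumpRates.marginal_add_period _ hπ (hper t) ht zero_le_one, add_comm,
    JumpRates.marginal_add_period _ hπ (hper 1) zero_le_one ht, hπ₁]

lemma pos_of_isInvariant (hirr : IsIrreducible r) (hπ : (unperturbed r hr hpos).IsInvariant π)
    (x : X) : 0 < π x := by
  rw [← hπ.2 1 zero_le_one]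
  exact JumpRates.marginal_pos _ (isIrreducible_unperturbed hirr) hπ.1 one_pos x

lemma forwardGen_eq_zero_of_isInvariant (hπ : (unperturbed r hr hpos).IsInvariant π) :
    forwardGen r π = 0 := by
  have hsol : (unperturbed r hr hpos).marginal π ∈ solutions fun _ => forwardGen r :=
    (unperturbed r hr hpos).marginal_mem_forwardSolutions hπ.1
  have h := eq_add_integral_of_mem_solutions hsol zero_le_one
  have hconst : ∫ u in (0 : ℝ)..1, forwardGen r ((unperturbed r hr hpos).marginal π u) =
      ∫ _ in (0 : ℝ)..1, forwardGen r π :=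
    intervalIntegral.integral_congr fun u hu => by
      rw [uIcc_of_le zero_le_one] at hu
      simp only [hπ.2 u hu.1]
  rw [hπ.2 1 zero_le_one, JumpRates.marginal_zero _ hπ.1] at h
  simpa [hconst] using h

end MarkovChain

/-! ### Linear response -/

namespace MarkovChain

open Asymptotics Filter LinearODE Topology

variable {X : Type*} [Fintype X] {r : X → X → ℝ} {g : ℝ → X → X → ℝ}

lemma isLittleO_exp_mul_sub_one_sub {f : ℝ → ℝ} (hf : ∃ C, ∀ t, |f t| ≤ C) :
    (fun q : ℝ × ℝ => Real.exp (q.1 * f q.2) - 1 - q.1 * f q.2) =o[𝓝 0 ×ˢ ⊤] fun q => q.1 := by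
  have hO : (fun q : ℝ × ℝ => q.1 * f q.2) =O[𝓝 0 ×ˢ ⊤] fun q => q.1 := by
    obtain ⟨C, hC⟩ := hf
    refine .of_bound C (.of_forall fun q => ?_)
    rw [norm_mul, mul_comm]
    exact mul_le_mul_of_nonneg_right (hC q.2) (norm_nonneg _)
  have hexp : (fun x => Real.exp x - 1 - x) =o[𝓝 0] fun x => x := by
    simpa using hasDerivAt_iff_isLittleO_nhds_zero.1 (Real.hasDerivAt_exp 0)
  exact (hexp.comp_tendsto (hO.trans_tendsto tendsto_fst)).trans_isBigO hO

lemma exists_norm_mul_le (r : X → X → ℝ) (hgb : ∃ G : ℝ, ∀ t x y, |g t x y| ≤ G) :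
    ∃ C, ∀ t, ‖r * g t‖ ≤ C := by
  obtain ⟨G, hG⟩ := hgb
  refine ⟨‖r‖ * |G|, fun t => norm_mul_le_of_le le_rfl ?_⟩
  exact (pi_norm_le_iff_of_nonneg (abs_nonneg G)).2 fun x =>
    (pi_norm_le_iff_of_nonneg (abs_nonneg G)).2 fun y => (hG t x y).trans (le_abs_self G)

lemma forwardGen_mul_mem_boundedForcings (hgm : ∀ x y, Measurable fun t => g t x y)
    (hgb : ∃ G : ℝ, ∀ t x y, |g t x y| ≤ G) {π : X → ℝ} (hπ : π ∈ stdSimplex ℝ X) :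
    (fun u => forwardGen (r * g u) π) ∈ boundedForcings (massZero X) :=
  forwardGen_mem_boundedForcings (measurable_pi_iff.2 fun x => measurable_pi_iff.2 fun y =>
    (hgm x y).const_mul (r x y)) (exists_norm_mul_le r hgb) measurable_const fun _ => hπ

variable {hr : ∀ x y, 0 ≤ r x y} {hpos : ∀ x, 0 < ∑ y, r x y}
  {hgm : ∀ x y, Measurable fun t => g t x y} {hgb : ∃ G : ℝ, ∀ t x y, |g t x y| ≤ G}

lemma periodic_perturbed_rate {T : ℝ} (hper : ∀ x y, Function.Periodic (fun t => g t x y) T)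
    (lam : ℝ) : Function.Periodic (perturbed r hr hpos g hgm hgb lam).rate T := fun t =>
  funext₂ fun x y => congrArg (fun c => Real.exp (lam * c) * r x y) (hper x y t)

lemma isLittleO_forwardGen_perturbed_rate :
    (fun q : ℝ × ℝ => forwardGen ((perturbed r hr hpos g hgm hgb q.1).rate q.2) - forwardGen r -
      q.1 • forwardGen (r * g q.2)) =o[𝓝 0 ×ˢ ⊤] fun q => q.1 := by
  simp only [← map_sub, ← map_smul]
  refine ((forwardGen (X := X)).isBigO_comp _ _).trans_isLittleO
    (isLittleO_pi.2 fun x => isLittleO_pi.2 fun y => ?_)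
  refine ((isLittleO_exp_mul_sub_one_sub (hgb.imp fun _ h t => h t x y)).const_mul_left
    (r x y)).congr_left fun q => ?_
  simp only [perturbed, Pi.sub_apply, Pi.smul_apply, Pi.mul_apply, smul_eq_mul]
  ring

variable [MeasurableSpace X] [MeasurableSingletonClass X] [Nonempty X] {T : ℝ} {π : X → ℝ}
  {oss : ℝ → X → ℝ} {t : ℝ}

theorem hasDerivAt_marginal (hirr : IsIrreducible r) (hT : 0 < T)
    (hper : ∀ x y, Function.Periodic (fun t => g t x y) T)
    (hπ : (unperturbed r hr hpos).IsInvariant π)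
    (hoss : ∀ lam, (perturbed r hr hpos g hgm hgb lam).IsPeriodicInvariant T (oss lam))
    (ht : 0 ≤ t) :
    HasDerivAt (fun lam => (perturbed r hr hpos g hgm hgb lam).marginal (oss lam) t)
      (expConvolution (forwardGen r) (fun u => forwardGen (r * g u) π) t) 0 := by
  have hR := periodic_perturbed_rate (hr := hr) (hpos := hpos) (hgm := hgm) (hgb := hgb) hper
  have hstable := isExpStableOn_forwardGen hr hpos hirr
  simp only [← (hoss _).periodicMarginal_eq (hR _) hT ht]
  refine hasDerivAt_of_sub_eq_expConvolution hstable
    (fun lam => periodicMarginal_sub_eq_expConvolution hstable hπ.1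
      (forwardGen_eq_zero_of_isInvariant hπ) (hoss lam) (hR lam) hT)
    (fun lam => forwardGen_sub_mem_boundedForcings r (hoss lam).1 hT)
    (.of_bound 1 (.of_forall fun q => ?_)) ?_
    (forwardGen_mul_mem_boundedForcings hgm hgb hπ.1) isLittleO_forwardGen_perturbed_rate t
  · simpa using norm_le_one_of_mem_stdSimplex
      (JumpRates.periodicMarginal_mem_stdSimplex _ (hoss q.1).1 hT q.2)
  · obtain ⟨C, hC⟩ := exists_norm_mul_le r hgb
    exact .of_bound (‖forwardGen (X := X)‖ * C) (.of_forall fun u => by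
      simpa using forwardGen.le_opNorm_of_le (hC u))

end MarkovChain

lemma mul_exp_smul_apply_of_semiconj {𝔸 : Type*} [NormedRing 𝔸] [NormedAlgebra ℝ 𝔸]
    [CompleteSpace 𝔸] {A B : 𝔸 →L[ℝ] 𝔸} {c : 𝔸} (h : ∀ v, c * A v = B (c * v)) (s : ℝ) (v : 𝔸) :
    c * NormedSpace.exp (s • A) v = NormedSpace.exp (s • B) (c * v) := by
  let _ : NormedAlgebra ℚ (𝔸 →L[ℝ] 𝔸) := .restrictScalars ℚ ℝ _
  have hsemiconj : SemiconjBy (ContinuousLinearMap.mul ℝ 𝔸 c) (s • A) (s • B) :=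
    ContinuousLinearMap.ext fun v => by simp [h]
  exact DFunLike.congr_fun hsemiconj.exp_right v

namespace MarkovChain

open LinearODE

variable {X : Type*} [Fintype X] {r : X → X → ℝ} {g : ℝ → X → X → ℝ} {π : X → ℝ}

lemma mul_LStar (hπ : ∀ x, π x ≠ 0) (hπ₀ : forwardGen r π = 0) (f : X → ℝ) :
    π * LStar r π f = forwardGen r (π * f) := by
  funext y
  have hstationary : ∑ x, (π x * r x y - π y * r y x) = 0 := congrFun hπ₀ y
  have hLStar : LStar r π f y = ∑ x, rStar r π y x * (f x - f y) := rfl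
  rw [← sub_eq_zero, Pi.mul_apply, hLStar, forwardGen_apply, Finset.mul_sum,
    ← Finset.sum_sub_distrib, ← mul_zero (-f y), ← hstationary, Finset.mul_sum]
  refine Finset.sum_congr rfl fun x _ => ?_
  have := hπ y
  simp only [rStar, Pi.mul_apply]
  field_simp
  ring

lemma mul_psi (hπ : ∀ x, π x ≠ 0) (u : ℝ) : π * psi r g π u = forwardGen (r * g u) π := by
  funext y
  rw [Pi.mul_apply, psi, forwardGen_apply, Finset.mul_sum]
  refine Finset.sum_congr rfl fun x _ => ?_
  have := hπ y
  simp only [rStar, Pi.mul_apply]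
  field_simp

lemma exp_smul_LStar_psi (hπ : ∀ x, π x ≠ 0) (hπ₀ : forwardGen r π = 0) (s u : ℝ) :
    NormedSpace.exp (s • LStar r π) (psi r g π u) =
      π⁻¹ * NormedSpace.exp (s • forwardGen r) (forwardGen (r * g u) π) := by
  have hinv : π⁻¹ * π = 1 := funext fun x => inv_mul_cancel₀ (hπ x)
  rw [← mul_psi hπ, ← mul_exp_smul_apply_of_semiconj (mul_LStar hπ hπ₀), ← mul_assoc, hinv, one_mul]

variable [MeasurableSpace X] [MeasurableSingletonClass X] [Nonempty X]
  {hr : ∀ x y, 0 ≤ r x y} {hpos : ∀ x, 0 < ∑ y, r x y}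
  {hgm : ∀ x y, Measurable fun t => g t x y} {hgb : ∃ G : ℝ, ∀ t x y, |g t x y| ≤ G}
  {T : ℝ} {oss : ℝ → X → ℝ} {t : ℝ}

theorem linear_response (hirr : IsIrreducible r) (hT : 0 < T)
    (hper : ∀ x y, Function.Periodic (fun t => g t x y) T)
    (hπ : (unperturbed r hr hpos).IsInvariant π)
    (hoss : ∀ lam, (perturbed r hr hpos g hgm hgb lam).IsPeriodicInvariant T (oss lam))
    (ht : 0 ≤ t) :
    (∀ x, DifferentiableAt ℝ
      (fun lam => (perturbed r hr hpos g hgm hgb lam).marginal (oss lam) t x) 0) ∧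
    IntegrableOn (fun s : ℝ => NormedSpace.exp (s • LStar r π) (psi r g π (t - s))) (Ioi 0) ∧
    (fun x =>
      deriv (fun lam => (perturbed r hr hpos g hgm hgb lam).marginal (oss lam) t x) 0 / π x) =
      ∫ s in Ioi (0 : ℝ), NormedSpace.exp (s • LStar r π) (psi r g π (t - s)) := by
  have hderiv := hasDerivAt_pi.1 (hasDerivAt_marginal hirr hT hper hπ hoss ht)
  have hint := integrableOn_exp_smul_apply (isExpStableOn_forwardGen hr hpos hirr)
    (forwardGen_mul_mem_boundedForcings (r := r) hgm hgb hπ.1) t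
  simp only [exp_smul_LStar_psi (fun x => (pos_of_isInvariant hirr hπ x).ne')
    (forwardGen_eq_zero_of_isInvariant hπ)]
  refine ⟨fun x => (hderiv x).differentiableAt,
    (ContinuousLinearMap.mul ℝ (X → ℝ) π⁻¹).integrable_comp hint, funext fun x => ?_⟩
  rw [(hderiv x).deriv, div_eq_inv_mul]
  exact (congrFun ((ContinuousLinearMap.mul ℝ (X → ℝ) π⁻¹).integral_comp_comm hint) x).symm

end MarkovChain

theorem mainTheorem7 {X : Type*} [Fintype X] [Nonempty X] [MeasurableSpace X]
    [MeasurableSingletonClass X]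
    (r : X → X → ℝ) (hr : ∀ x y, 0 ≤ r x y) (hpos : ∀ x, 0 < ∑ y, r x y)
    (hirr : MarkovChain.IsIrreducible r)
    (g : ℝ → X → X → ℝ) (hgm : ∀ x y, Measurable fun t => g t x y)
    (hgb : ∃ G : ℝ, ∀ t x y, |g t x y| ≤ G)
    (T : ℝ) (hT : 0 < T) (hper : ∀ x y, Function.Periodic (fun t => g t x y) T) :
    (∃! π : X → ℝ, (MarkovChain.unperturbed r hr hpos).IsInvariant π) ∧
    (∀ lam : ℝ, ∃! ν : X → ℝ,
      (MarkovChain.perturbed r hr hpos g hgm hgb lam).IsPeriodicInvariant T ν) ∧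
    ∀ π : X → ℝ, (MarkovChain.unperturbed r hr hpos).IsInvariant π →
    ∀ oss : ℝ → X → ℝ,
      (∀ lam, (MarkovChain.perturbed r hr hpos g hgm hgb lam).IsPeriodicInvariant T (oss lam)) →
      (∀ x, 0 < π x) ∧
      -- the linear response of the initial distribution of the oscillatory steady state
      (∀ x, DifferentiableAt ℝ (fun lam => oss lam x) 0) ∧
      IntegrableOn (fun s : ℝ =>
        NormedSpace.exp (s • MarkovChain.LStar r π) (MarkovChain.psi r g π (-s))) (Ioi 0) ∧
      (fun x => deriv (fun lam => oss lam x) 0 / π x) =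
        ∫ s in Ioi (0 : ℝ),
          NormedSpace.exp (s • MarkovChain.LStar r π) (MarkovChain.psi r g π (-s)) ∧
      -- the linear response of the marginal at time `t` of the oscillatory steady state
      ∀ t : ℝ, 0 ≤ t →
        (∀ x, DifferentiableAt ℝ (fun lam =>
          (MarkovChain.perturbed r hr hpos g hgm hgb lam).marginal (oss lam) t x) 0) ∧
        IntegrableOn (fun s : ℝ =>
          NormedSpace.exp (s • MarkovChain.LStar r π) (MarkovChain.psi r g π (t - s))) (Ioi 0) ∧
        (fun x => deriv (fun lam =>
          (MarkovChain.perturbed r hr hpos g hgm hgb lam).marginal (oss lam) t x) 0 / π x) =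
          ∫ s in Ioi (0 : ℝ),
            NormedSpace.exp (s • MarkovChain.LStar r π) (MarkovChain.psi r g π (t - s)) := by
  refine ⟨MarkovChain.existsUnique_isInvariant hirr, fun lam =>
    JumpRates.existsUnique_isPeriodicInvariant _ (MarkovChain.isIrreducible_perturbed hirr lam) hT,
    fun π hπ oss hoss => ⟨MarkovChain.pos_of_isInvariant hirr hπ, ?_⟩⟩
  have hresponse {t : ℝ} (ht : 0 ≤ t) := MarkovChain.linear_response hirr hT hper hπ hoss ht
  obtain ⟨hdiff, hint, heq⟩ := hresponse le_rfl
  simp only [JumpRates.marginal_zero _ (hoss _).1, zero_sub] at hdiff hint heq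
  exact ⟨hdiff, hint, heq, fun t ht => hresponse ht⟩
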